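/- Let $n\ge 0$, let $F$ be a field of characteristic $0$, let $\mathbf a=(a_0,a_1,a_2,\dots)$ be a sequence of elements of $F$ with $a_0=0$ (for instance $F=\mathbb Q(a_1,a_2,\dots)$ with $a_1,a_2,\dots$ indeterminates), and let $\mathbf x=(x_1,\dots,x_n)$ and $t$ be indeterminates. Put $(x|\mathbf a)^r=\prod_{i=0}^{r-1}(x+a_i)$. For a partition $\lambda=(\lambda_1\ge\dots\ge\lambda_n\ge 0)$ of length $l(\lambda)\le n$, in which the part $k$ occurs $m_k$ times among $\lambda_1,\dots,\lambda_n$ ($k\ge 0$), the factorial symplectic Hall--Littlewood function is $$\mathcal P^C_\lambda(\mathbf x|\mathbf a;t)=\frac1{v^{(n)}_\lambda(t)}\sum_{w\in W_n}w\left(\prod_{i=1}^n(x_i|\mathbf a)^{\lambda_i}\prod_{i=1}^n\frac{1-tx_i^{-2}}{1-x_i^{-2}}\prod_{1\le i<j\le n}\frac{1-tx_i^{-1}x_j}{1-x_i^{-1}x_j}\,\frac{1-tx_i^{-1}x_j^{-1}}{1-x_i^{-1}x_j^{-1}}\right),$$ $$v^{(n)}_\lambda(t)=\prod_{i=1}^{m_0}\frac{1-t^{2i}}{1-t}\;\prod_{k\ge1}\prod_{i=1}^{m_k}\frac{1-t^i}{1-t},$$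 where the Weyl group $W_n$ of type $C_n$ acts on $F(x_1,\dots,x_n)(t)$ by permuting the variables $x_i$ and replacing some of them by $x_i^{-1}$. A symplectic primed shifted tableau of shape $\lambda$, for a strict partition $\lambda$ of length $\le n$, is a filling $T$ of the shifted diagram $S(\lambda)=\{(i,j): 1\le i\le l(\lambda),\ i\le j\le \lambda_i+i-1\}$ with letters of the totally ordered alphabet $$1'<1<\overline1'<\overline1<2'<2<\overline2'<\overline2<\dots<n'<n<\overline n'<\overline n$$ such that rows and columns are weakly increasing, each of the letters $k',\overline k'$ occurs at most once in every row, each of the letters $k,\overline k$ occurs at most once in every column, and, for each $k$, at most one cell of the main diagonal contains a letter from $\{k',k,\overline k',\overline k\}$. Let $\mathrm{QTab}^C_n(\lambda)$ be the set of these tableaux, and put $(\mathbf x|\mathbf a)^T=\prod_{(i,j)\in S(\lambda)}\mathrm{wt}(T_{i,j};i,j)$, where $$\mathrm{wt}(k';i,j)=x_k-a_{j-i},\quad \mathrm{wt}(k;i,j)=x_k+a_{j-i},\quad \mathrm{wt}(\overline k';i,j)=x_k^{-1}-a_{j-i},\quad \mathrm{wt}(\overline k;i,j)=x_k^{-1}+a_{j-i}.$$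 Theorem. For every strict partition $\lambda$ of length $\le n$, the rational function $\mathcal P^C_\lambda(\mathbf x|\mathbf a;t)$ of $t$ has no pole at $t=-1$, and the factorial symplectic $Q$-function $Q^C_\lambda(\mathbf x|\mathbf a)=2^{l(\lambda)}\,\mathcal P^C_\lambda(\mathbf x|\mathbf a;-1)$ satisfies $$Q^C_\lambda(\mathbf x|\mathbf a)=\sum_{T\in \mathrm{QTab}^C_n(\lambda)}(\mathbf x|\mathbf a)^T .$$ -/

import Mathlib

open Finset

noncomputable section

namespace SymplecticQ

/-! ### Partitions, the hyperoctahedral group and rational functions -/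

/-- `lam = (lam₁, …, lamₙ)`, padded by zeros, is a strict partition of length at most `n`:
it is weakly decreasing and its nonzero parts are pairwise distinct. -/
def IsStrictPartition {n : ℕ} (lam : Fin n → ℕ) : Prop :=
  Antitone lam ∧ ∀ i j, i < j → lam i ≠ 0 → lam j < lam i

/-- The multiplicity of `k` in `(lam₁, …, lamₙ)`. -/
def mult {n : ℕ} (lam : Fin n → ℕ) (k : ℕ) : ℕ := #{i | lam i = k}

/-- The length of `lam`: the number of its nonzero parts. -/
def length {n : ℕ} (lam : Fin n → ℕ) : ℕ := #{i | lam i ≠ 0}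

/-- The underlying set of the Weyl group of type `Cₙ`: signed permutations `w = (σ, ε)`. -/
abbrev SignedPerm (n : ℕ) : Type := Equiv.Perm (Fin n) × (Fin n → ℤˣ)

/-- The action of a signed permutation on the variables: `w xᵢ = x_{σ(i)} ^ {ε_{σ(i)}}`. -/
def SignedPerm.actVar {n : ℕ} {L : Type*} [Field L] (w : SignedPerm n) (x : Fin n → L) :
    Fin n → L :=
  fun i => x (w.1 i) ^ ((w.2 (w.1 i) : ℤˣ) : ℤ)

/-- The field `F(x₁, …, xₙ)` of rational functions. -/
abbrev RatField (n : ℕ) (F : Type*) [Field F] : Type _ := FractionRing (MvPolynomial (Fin n) F)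

/-- The variable `xᵢ` in `F(x₁, …, xₙ)`. -/
def xVar {n : ℕ} (F : Type*) [Field F] (i : Fin n) : RatField n F :=
  algebraMap (MvPolynomial (Fin n) F) (RatField n F) (MvPolynomial.X i)

/-! ### The factorial Hall–Littlewood function of type C -/

/-- The factorial monomial `(x|a)^r = ∏_{0 ≤ i < r} (x + aᵢ)`. -/
def facMonomial {L : Type*} [Field L] (a : ℕ → L) (x : L) (r : ℕ) : L :=
  ∏ i ∈ range r, (x + a i)

/-- The rational function of `x₁, …, xₙ` which is symmetrized over the Weyl group. -/
def hlSummand {n : ℕ} {L : Type*} [Field L] (lam : Fin n → ℕ) (a : ℕ → L) (t : L)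
    (x : Fin n → L) : L :=
  (∏ i, facMonomial a (x i) (lam i)) *
  (∏ i, (1 - t * (x i)⁻¹ ^ 2) / (1 - (x i)⁻¹ ^ 2)) *
  ∏ i, ∏ j ∈ Ioi i,
    ((1 - t * (x i)⁻¹ * x j) / (1 - (x i)⁻¹ * x j) *
      ((1 - t * (x i)⁻¹ * (x j)⁻¹) / (1 - (x i)⁻¹ * (x j)⁻¹)))

/-- The normalizing factor
`v_lam(t) = ∏_{i=1}^{m₀} (1 - t^{2i})/(1 - t) * ∏_{k ≥ 1} ∏_{i=1}^{m_k} (1 - t^i)/(1 - t)`,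
where `m_k` is the multiplicity of `k` in `(lam₁, …, lamₙ)`; it is the Poincaré polynomial of the
stabilizer of `lam` in the Weyl group. -/
def vFactor {n : ℕ} {L : Type*} [Field L] (lam : Fin n → ℕ) (t : L) : L :=
  (∏ i ∈ Icc 1 (mult lam 0), (1 - t ^ (2 * i)) / (1 - t)) *
  ∏ k ∈ (univ.image lam).erase 0, ∏ i ∈ Icc 1 (mult lam k), (1 - t ^ i) / (1 - t)

/-- The factorial symplectic Hall–Littlewood function, an element of `F(x₁, …, xₙ)(t)`. -/
def facHL {n : ℕ} {F : Type*} [Field F] (lam : Fin n → ℕ) (a : ℕ → F) :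
    RatFunc (RatField n F) :=
  1 / vFactor lam RatFunc.X *
    ∑ w : SignedPerm n,
      hlSummand lam (fun i => RatFunc.C (algebraMap F (RatField n F) (a i))) RatFunc.X
        (w.actVar fun i => RatFunc.C (xVar F i))

/-- The factorial symplectic `P`-function: the specialization `t = -1` of the rational function
`facHL lam a` of `t`. -/
def facP {n : ℕ} {F : Type*} [Field F] (lam : Fin n → ℕ) (a : ℕ → F) : RatField n F :=
  (facHL lam a).eval (RingHom.id _) (-1)

/-- The factorial symplectic `Q`-function. -/
def facQ {n : ℕ} {F : Type*} [Field F] (lam : Fin n → ℕ) (a : ℕ → F) : RatField n F :=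
  2 ^ length lam * facP lam a

/-! ### Symplectic primed shifted tableaux -/

/-- The letters `k'`, `k`, `k̄'`, `k̄` for `k = 1, …, n` (indexed from `0`). -/
inductive Letter (n : ℕ) : Type
  | primed (k : Fin n)
  | plain (k : Fin n)
  | barPrimed (k : Fin n)
  | bar (k : Fin n)
  deriving DecidableEq, Fintype

/-- The index `k` of a letter. -/
def Letter.index {n : ℕ} : Letter n → Fin n
  | primed k => k
  | plain k => k
  | barPrimed k => k
  | bar k => k

/-- Whether the letter carries a prime. -/
def Letter.IsPrimed {n : ℕ} : Letter n → Prop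
  | primed _ => True
  | plain _ => False
  | barPrimed _ => True
  | bar _ => False

/-- The position of a letter in the total order
`1' < 1 < 1̄' < 1̄ < 2' < 2 < 2̄' < 2̄ < ⋯ < n' < n < n̄' < n̄`. -/
def Letter.rank {n : ℕ} : Letter n → ℕ
  | primed k => 4 * k
  | plain k => 4 * k + 1
  | barPrimed k => 4 * k + 2
  | bar k => 4 * k + 3

/-- The cells of the shifted diagram of `lam`. The pair `⟨i, d⟩` with `0 ≤ d < lamᵢ` is the cell
`(i, j)` in row `i` and column `j = i + d`. -/
abbrev Cell {n : ℕ} (lam : Fin n → ℕ) : Type := (i : Fin n) × Fin (lam i)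

/-- The row `i` of a cell `(i, j)`. -/
def Cell.row {n : ℕ} {lam : Fin n → ℕ} (c : Cell lam) : ℕ := c.1

/-- The content `j - i` of a cell `(i, j)`. -/
def Cell.content {n : ℕ} {lam : Fin n → ℕ} (c : Cell lam) : ℕ := c.2

/-- The column `j` of a cell `(i, j)`. -/
def Cell.col {n : ℕ} {lam : Fin n → ℕ} (c : Cell lam) : ℕ := Cell.row c + Cell.content c

/-- `T` is a symplectic primed shifted tableau of shape `lam`. -/
structure IsTableau {n : ℕ} {lam : Fin n → ℕ} (T : Cell lam → Letter n) : Prop where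
  /-- Rows are weakly increasing from left to right. -/
  row_weak : ∀ c d, Cell.row c = Cell.row d → Cell.col c ≤ Cell.col d → (T c).rank ≤ (T d).rank
  /-- Columns are weakly increasing from top to bottom. -/
  col_weak : ∀ c d, Cell.col c = Cell.col d → Cell.row c ≤ Cell.row d → (T c).rank ≤ (T d).rank
  /-- Each primed letter appears at most once in every row. -/
  row_primed : ∀ c d, Cell.row c = Cell.row d → T c = T d → (T c).IsPrimed → c = d
  /-- Each unprimed letter appears at most once in every column. -/
  col_unprimed : ∀ c d, Cell.col c = Cell.col d → T c = T d → ¬ (T c).IsPrimed → c = d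
  /-- For each `k`, at most one of the letters `k'`, `k`, `k̄'`, `k̄` is on the main diagonal,
  and it appears there at most once. -/
  diag : ∀ c d, Cell.content c = 0 → Cell.content d = 0 → (T c).index = (T d).index → c = d

open Classical in
/-- The finite set of symplectic primed shifted tableaux of shape `lam`. -/
def tableaux {n : ℕ} (lam : Fin n → ℕ) : Finset (Cell lam → Letter n) := {T | IsTableau T}

/-- The factorial weight of a letter in a cell of content `m = j - i`. -/
def letterWeight {n : ℕ} {L : Type*} [Field L] (a : ℕ → L) (x : Fin n → L) (m : ℕ) :
    Letter n → L
  | .primed k => x k - a m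
  | .plain k => x k + a m
  | .barPrimed k => (x k)⁻¹ - a m
  | .bar k => (x k)⁻¹ + a m

/-- The factorial weight `(x|a)^T` of a tableau, an element of `F(x₁, …, xₙ)`. -/
def tableauWeight {n : ℕ} {F : Type*} [Field F] {lam : Fin n → ℕ} (a : ℕ → F)
    (T : Cell lam → Letter n) : RatField n F :=
  ∏ c, letterWeight (fun i => algebraMap F (RatField n F) (a i)) (xVar F) (Cell.content c) (T c)

end SymplecticQ

end

noncomputable section

namespace SymplecticQ

/-! ### Partial fractions -/

/-! Both sides equal one symmetrized sum. Put z_i = x_i + x_i⁻¹, θ(i,j) = (z_i + z_j)/(z_i - z_j)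
and f_i = `oneRow a (x i)`. The common value, `altSum`, runs over the injections s of the l nonzero
rows into the variables, with summand ∏_{i<j} θ(s_i,s_j) · ∏_{i, m ∉ im s} θ(s_i,m) · ∏_i
f_{s_i}(λ_i).

Hall–Littlewood side. Peeling off the first variable gives a recursion (`hlSum_succ`). The zero
parts of λ contribute the Poincaré polynomial of type C of rank n - l (`hlSum_zero`, by partial
fractions), and this is exactly v_λ since the positive parts are distinct. It vanishes at t = -1
when n > l, so it is cancelled before specializing; the cofactor is a polynomial in t
(`hlSum_eq_poincare_mul`). At t = -1 the pair factors become θ, which does not see x_i ↦ x_i⁻¹, so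
summing over the sign of the peeled variable gives f_i/2 times a product of θ's (`sum_headFactor`).
The halves account for 2^l.

Tableau side. Removing the largest letter removes a vertical strip (primed) or a horizontal strip
(unprimed). The resulting transfer matrices act on determinants det(v_j(λ_i)) column by column, as
for free fermions (`seqDet_vertOp`, `seqDet_horOp`); the four letters of one index compose to
`blockOp`. The diagonal condition lets a block create at most one row, and the birth of a row is
encoded by an extra column `unitSeq`. The block of index k sends `unitSeq` to `unitSeq` + f_k and
f_j to θ(j,k) f_j - (θ(j,k) + 1) f_k. On the other hand the coefficients of `altSum` alternate in s,
so l! · `altSum` is a sum of determinants, and a partial fraction identity (`prod_theta`) shows that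
adjoining the variable x_k changes it in the same way (`altSum_insert`). Induction on the number of
indices concludes (`fillingSum_eq_altSum`). -/

theorem prod_sub_mul_div_sub {ι K : Type*} [Field K] [DecidableEq ι] (s : Finset ι) (z : ι → K)
    (hz : Set.InjOn z s) (t y : K) (hy : ∀ i ∈ s, y ≠ z i) :
    ∏ i ∈ s, (y - t * z i) / (y - z i) =
      1 + ∑ i ∈ s, (1 - t) * z i / (y - z i) *
        ∏ j ∈ s.erase i, (z i - t * z j) / (z i - z j) := by
  classical
  set P : Polynomial K := Lagrange.nodal s (fun i => t * z i) with hP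
  set N : Polynomial K := Lagrange.nodal s z with hN
  -- Two monic polynomials of equal degree: the difference is determined by its values at the nodes
  -- `z i`, where `N` vanishes. Dividing its Lagrange interpolant by `N` is the partial fraction
  -- expansion.
  have hdeg : (P - N).degree < #s := by
    have h1 : P.degree = #s := Lagrange.degree_nodal
    have h2 : N.degree = #s := Lagrange.degree_nodal
    rw [← h1]
    exact Polynomial.degree_sub_lt_left (h1.trans h2.symm) (Lagrange.nodal_ne_zero)
      (by rw [Lagrange.nodal_monic.leadingCoeff, Lagrange.nodal_monic.leadingCoeff])
  have hI : P - N = Lagrange.interpolate s z (fun i => ∏ j ∈ s, (z i - t * z j)) := by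
    refine Lagrange.eq_interpolate_of_eval_eq _ hz hdeg fun i hi => ?_
    rw [Polynomial.eval_sub, hN, Lagrange.eval_nodal_at_node hi, hP, Lagrange.eval_nodal, sub_zero]
  have hev := congrArg (Polynomial.eval y) hI
  rw [Lagrange.eval_interpolate_not_at_node _ hy, Polynomial.eval_sub, hP, hN,
    Lagrange.eval_nodal, Lagrange.eval_nodal] at hev
  have hne : ∏ i ∈ s, (y - z i) ≠ 0 := prod_ne_zero_iff.2 fun i hi => sub_ne_zero.2 (hy i hi)
  rw [prod_div_distrib, div_eq_iff hne, add_mul, one_mul]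
  rw [sub_eq_iff_eq_add'] at hev
  rw [hev, mul_comm (∏ i ∈ s, (y - z i))]
  congr 2
  refine sum_congr rfl fun i hi => ?_
  rw [Lagrange.nodalWeight, prod_inv_distrib, prod_div_distrib, ← mul_prod_erase s _ hi]
  field_simp

/-! ### Symmetrized products -/

section Coef

variable {ι K : Type*} [Field K]

/-- The cross ratio `(zᵢ + zⱼ) / (zᵢ - zⱼ)`. -/
def theta (z : ι → K) (i j : ι) : K := (z i + z j) / (z i - z j)

theorem theta_neg (z : ι → K) (i j : ι) : theta z i j = -theta z j i := by
  rw [theta, theta, ← div_neg, neg_sub, add_comm]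

theorem prod_Ioi_snoc (g : ι → ι → K) {l : ℕ} (s : Fin l → ι) (k : ι) :
    ∏ i : Fin (l + 1), ∏ j ∈ Ioi i, g ((Fin.snoc s k : Fin (l + 1) → ι) i)
      ((Fin.snoc s k : Fin (l + 1) → ι) j) =
    (∏ i, ∏ j ∈ Ioi i, g (s i) (s j)) * ∏ i, g (s i) k := by
  have h : ∀ (m : ℕ) (u : Fin m → ι) (i : Fin m), ∏ j ∈ Ioi i, g (u i) (u j) =
      ∏ j, if i < j then g (u i) (u j) else 1 := by
    intro m u i
    rw [← prod_filter]
    congr 1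
    ext j
    simp
  simp only [h]
  rw [Fin.prod_univ_castSucc, ← prod_mul_distrib]
  simp only [Fin.prod_univ_castSucc, Fin.snoc_castSucc, Fin.snoc_last,
    Fin.castSucc_lt_castSucc_iff, Fin.castSucc_lt_last, if_true, lt_irrefl, if_false, mul_one,
    (Fin.castSucc_lt_last _).not_gt, prod_const_one]

variable [DecidableEq ι]

/-- Partial fractions with t = -1, evaluated at `z k`. In `altSum_insert` the left side is the
weight of selecting `k` itself, and the term of `q` is the weight of selecting `q` and having f_q
replaced by f_k. -/
theorem prod_theta (z : ι → K) (k : ι) (B : Finset ι) (hz : Set.InjOn z (insert k B : Finset ι))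
    (hk : k ∉ B) :
    ∏ m ∈ B, theta z k m =
      1 - ∑ q ∈ B, (theta z q k + 1) * ∏ m ∈ B.erase q, theta z q m := by
  have hne : ∀ i ∈ B, z k ≠ z i := fun i hi h =>
    hk (hz (by simp) (by simp [hi]) h ▸ hi)
  have h := prod_sub_mul_div_sub B z (hz.mono (by simp)) (-1) (z k) hne
  simp only [neg_one_mul, sub_neg_eq_add] at h
  unfold theta
  rw [h, sub_eq_add_neg, ← sum_neg_distrib]
  congr 1
  refine sum_congr rfl fun q hq => ?_
  rw [← neg_mul]
  congr 1
  have h1 := sub_ne_zero.2 (hne q hq)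
  have h2 := sub_ne_zero.2 (hne q hq).symm
  field_simp
  ring

/-- The coefficient attached to an injection of `Fin l` into `A`. -/
def coef (z : ι → K) (A : Finset ι) {l : ℕ} (s : Fin l → ι) : K :=
  open Classical in
  if Function.Injective s ∧ ∀ i, s i ∈ A then
    (∏ i, ∏ j ∈ Ioi i, theta z (s i) (s j)) * ∏ i, ∏ m ∈ A \ univ.image s, theta z (s i) m
  else 0

/-- The pair product is alternating because `theta` is antisymmetric; the other product depends only
on the image of `s`. -/
theorem coef_comp_perm (z : ι → K) (A : Finset ι) {l : ℕ} (s : Fin l → ι)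
    (τ : Equiv.Perm (Fin l)) :
    coef z A (s ∘ τ) = (Equiv.Perm.sign τ : ℤ) * coef z A s := by
  unfold coef
  have h1 : (Function.Injective (s ∘ τ) ∧ ∀ i, (s ∘ τ) i ∈ A) ↔
      (Function.Injective s ∧ ∀ i, s i ∈ A) := by
    rw [τ.injective_comp]
    refine and_congr_right fun _ => ⟨fun h i => ?_, fun h i => h _⟩
    simpa using h (τ.symm i)
  have h2 : univ.image (s ∘ τ) = univ.image s := by
    ext m
    simp only [mem_image, mem_univ, true_and, Function.comp]
    exact ⟨fun ⟨a, h⟩ => ⟨_, h⟩, fun ⟨a, h⟩ => ⟨τ.symm a, by simpa using h⟩⟩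
  have h3 : ∏ i, ∏ m ∈ A \ univ.image (s ∘ τ), theta z ((s ∘ τ) i) m =
      ∏ i, ∏ m ∈ A \ univ.image s, theta z (s i) m := by
    rw [h2]
    exact Equiv.prod_comp τ fun i => ∏ m ∈ A \ univ.image s, theta z (s i) m
  have h4 := τ.prod_Ioi_comp_eq_sign_mul_prod (f := fun i j => theta z (s i) (s j))
    (fun i j => theta_neg _ _ _)
  by_cases h : Function.Injective s ∧ ∀ i, s i ∈ A
  · rw [if_pos h, if_pos (h1.2 h), h3, ← mul_assoc, ← h4]
    rfl
  · rw [if_neg h, if_neg (fun h' => h (h1.1 h')), mul_zero]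

theorem image_snoc {l : ℕ} (s : Fin l → ι) (k : ι) :
    univ.image (Fin.snoc s k : Fin (l + 1) → ι) = insert k (univ.image s) := by
  ext m
  simp only [mem_image, mem_univ, true_and, Fin.exists_fin_succ', Fin.snoc_castSucc,
    Fin.snoc_last, mem_insert]
  rw [or_comm, eq_comm (a := k)]

theorem image_cons {l : ℕ} (s : Fin l → ι) (k : ι) :
    univ.image (Fin.cons k s : Fin (l + 1) → ι) = insert k (univ.image s) := by
  ext m
  simp only [mem_image, mem_univ, true_and, Fin.exists_fin_succ, Fin.cons_succ,
    Fin.cons_zero, mem_insert]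
  rw [eq_comm (a := k)]

theorem coef_snoc_of_mem (z : ι → K) (A : Finset ι) {l : ℕ} (s : Fin l → ι) (k : ι)
    (hk : k ∈ A) (hs : ∀ i, s i ≠ k) :
    coef z A (Fin.snoc s k : Fin (l + 1) → ι) =
      coef z A s * ∏ m ∈ (A \ univ.image s).erase k, theta z k m := by
  unfold coef
  have h1 : (Function.Injective (Fin.snoc s k : Fin (l + 1) → ι) ∧
      ∀ i, (Fin.snoc s k : Fin (l + 1) → ι) i ∈ A) ↔ (Function.Injective s ∧ ∀ i, s i ∈ A) := by
    rw [Fin.snoc_injective_iff, Fin.forall_fin_succ']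
    simp only [Fin.snoc_castSucc, Fin.snoc_last, Set.mem_range, not_exists]
    tauto
  by_cases h : Function.Injective s ∧ ∀ i, s i ∈ A
  · have h2 : A \ univ.image (Fin.snoc s k : Fin (l + 1) → ι) = (A \ univ.image s).erase k := by
      rw [image_snoc]
      ext m
      simp only [mem_sdiff, mem_insert, mem_erase]
      tauto
    have hk' : k ∈ A \ univ.image s := by
      simp only [mem_sdiff, hk, mem_image, mem_univ, true_and, not_exists]
      exact hs
    rw [if_pos h, if_pos (h1.2 h), h2, prod_Ioi_snoc, Fin.prod_univ_castSucc]
    simp only [Fin.snoc_castSucc, Fin.snoc_last, ← mul_prod_erase _ _ hk', prod_mul_distrib]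
    ring
  · rw [if_neg h, if_neg (fun h' => h (h1.1 h')), zero_mul]

theorem coef_insert (z : ι → K) (A : Finset ι) {l : ℕ} (s : Fin l → ι) (k : ι)
    (hk : k ∉ A) (hs : ∀ i, s i ≠ k) :
    coef z (insert k A) s = coef z A s * ∏ i, theta z (s i) k := by
  unfold coef
  have h1 : (Function.Injective s ∧ ∀ i, s i ∈ insert k A) ↔
      (Function.Injective s ∧ ∀ i, s i ∈ A) := by
    simp [mem_insert, hs]
  by_cases h : Function.Injective s ∧ ∀ i, s i ∈ A
  · have h2 : insert k A \ univ.image s = insert k (A \ univ.image s) :=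
      insert_sdiff_of_notMem _ (by simpa using hs)
    have hk' : k ∉ A \ univ.image s := by simp [hk]
    rw [if_pos h, if_pos (h1.2 h), h2]
    simp only [prod_insert hk', prod_mul_distrib]
    ring
  · rw [if_neg h, if_neg (fun h' => h (h1.1 h')), zero_mul]

theorem coef_snoc_insert (z : ι → K) (A : Finset ι) {l : ℕ} (s : Fin l → ι) (k : ι)
    (hk : k ∉ A) :
    coef z (insert k A) (Fin.snoc s k : Fin (l + 1) → ι) =
      coef z A s * (∏ i, theta z (s i) k) * ∏ m ∈ A \ univ.image s, theta z k m := by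
  by_cases hs : ∀ i, s i ≠ k
  · have hk' : k ∉ A \ univ.image s := by simp [hk]
    rw [coef_snoc_of_mem _ _ _ _ (mem_insert_self _ _) hs, coef_insert _ _ _ _ hk hs,
      insert_sdiff_of_notMem _ (by simpa using hs), erase_insert hk']
  · push Not at hs
    obtain ⟨i, hi⟩ := hs
    have h1 : coef z A s = 0 := if_neg fun h => hk (hi ▸ h.2 i)
    have h2 : coef z (insert k A) (Fin.snoc s k : Fin (l + 1) → ι) = 0 := if_neg fun h => by
      have := (Fin.snoc_injective_iff.1 h.1).2
      exact this ⟨i, hi⟩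
    rw [h1, h2, zero_mul, zero_mul]

/-- The pair factors and the complement factors of the first index merge into a product over all of
`A.erase k`, independent of `s`. This gives the recursion on the first row. -/
theorem coef_cons (z : ι → K) (A : Finset ι) {l : ℕ} (s : Fin l → ι) (k : ι)
    (hk : k ∈ A) :
    coef z A (Fin.cons k s : Fin (l + 1) → ι) =
      coef z (A.erase k) s * ∏ m ∈ A.erase k, theta z k m := by
  unfold coef
  have h1 : (Function.Injective (Fin.cons k s : Fin (l + 1) → ι) ∧
      ∀ i, (Fin.cons k s : Fin (l + 1) → ι) i ∈ A) ↔
      (Function.Injective s ∧ ∀ i, s i ∈ A.erase k) := by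
    rw [Fin.cons_injective_iff, Fin.forall_fin_succ]
    simp only [Fin.cons_succ, Fin.cons_zero, Set.mem_range, not_exists, mem_erase,
      forall_and, ne_eq]
    tauto
  by_cases h : Function.Injective s ∧ ∀ i, s i ∈ A.erase k
  · have h2 : A \ univ.image (Fin.cons k s : Fin (l + 1) → ι) = A.erase k \ univ.image s := by
      rw [image_cons]
      ext m
      simp only [mem_sdiff, mem_insert, mem_erase]
      tauto
    have h3 : (∏ i, theta z k (s i)) * ∏ m ∈ A.erase k \ univ.image s, theta z k m =
        ∏ m ∈ A.erase k, theta z k m := by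
      rw [← prod_image (s := univ) (f := fun m => theta z k m) h.1.injOn, mul_comm,
        prod_sdiff]
      intro m hm
      obtain ⟨i, -, rfl⟩ := mem_image.1 hm
      exact h.2 i
    rw [if_pos h, if_pos (h1.2 h), h2, ← h3, Fin.prod_univ_succ, Fin.prod_univ_succ]
    simp only [Fin.prod_Ioi_zero, Fin.prod_Ioi_succ, Fin.cons_zero, Fin.cons_succ]
    ring
  · rw [if_neg h, if_neg (fun h' => h (h1.1 h')), zero_mul]

end Coef
/-! ### Determinants of sequences -/

/-- The determinant with columns the sequences `v j`, evaluated at the indices `lam i`. -/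
def seqDet {K : Type*} [Field K] {l : ℕ} (v : Fin l → ℕ → K) (lam : Fin l → ℕ) : K :=
  (Matrix.of fun i j => v j (lam i)).det

theorem seqDet_comp_perm {K : Type*} [Field K] {l : ℕ} (v : Fin l → ℕ → K) (lam : Fin l → ℕ)
    (τ : Equiv.Perm (Fin l)) :
    seqDet (v ∘ τ) lam = (Equiv.Perm.sign τ : ℤ) * seqDet v lam := by
  exact Matrix.det_permute' τ (Matrix.of fun i j => v j (lam i))

/-- In the multilinear expansion a term with `u` in two columns vanishes, so only terms of degree at
most one in `d` survive. -/
theorem det_add_smul_col {K : Type*} [Field K] {l : ℕ} (v : Fin l → ℕ → K) (u : ℕ → K)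
    (c d : Fin l → K) (lam : Fin l → ℕ) :
    seqDet (fun j r => c j * v j r + d j * u r) lam =
      (∏ j, c j) * seqDet v lam +
        ∑ p, d p * (∏ j ∈ univ.erase p, c j) * seqDet (Function.update v p u) lam := by
  set A : Matrix (Fin l) (Fin l) K := Matrix.of fun i j => c j * v j (lam i) with hA
  have key : ∀ s : Finset (Fin l),
      (Matrix.of fun i j => A i j + if j ∈ s then d j * u (lam i) else 0).det =
        A.det + ∑ p ∈ s, d p * (A.updateCol p fun i => u (lam i)).det := by
    intro s
    induction s using Finset.induction_on with
    | empty => simp [Matrix.of]; rfl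
    | insert q s hq ih =>
      set B : Matrix (Fin l) (Fin l) K :=
        Matrix.of fun i j => A i j + if j ∈ s then d j * u (lam i) else 0 with hB
      have h1 : (Matrix.of fun i j => A i j + if j ∈ insert q s then d j * u (lam i) else 0) =
          B.updateCol q ((fun i => B i q) + d q • fun i => u (lam i)) := by
        ext i j
        by_cases hj : j = q
        · subst hj
          simp [hB, hq]
        · simp [hB, hj]
      -- Once column `q` is `u` itself, the multiples of `u` in the other columns can be cleared.
      have h2 : (B.updateCol q fun i => u (lam i)).det =
          (A.updateCol q fun i => u (lam i)).det := by
        rw [← Matrix.det_transpose, ← Matrix.det_transpose (A.updateCol _ _)]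
        refine Matrix.det_eq_of_forall_row_eq_smul_add_const
          (fun j => if j ∈ s then d j else 0) q (by simp [hq]) fun j i => ?_
        by_cases hj : j = q
        · subst hj
          simp [hq]
        · by_cases hjs : j ∈ s <;> simp [hB, hj, hjs]
      rw [h1, Matrix.det_updateCol_add, Matrix.det_updateCol_smul, Matrix.updateCol_eq_self, ih,
        h2, sum_insert hq]
      ring
  have h := key univ
  simp only [mem_univ, if_true] at h
  rw [seqDet, show (Matrix.of fun i j => c j * v j (lam i) + d j * u (lam i)) =
    Matrix.of fun i j => A i j + d j * u (lam i) from rfl, h]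
  congr 1
  · exact Matrix.det_mul_row c (Matrix.of fun i j => v j (lam i))
  · refine sum_congr rfl fun p _ => ?_
    rw [mul_assoc]
    congr 1
    have h3 : A.updateCol p (fun i => u (lam i)) = Matrix.of fun i j =>
        Function.update c p 1 j *
          (Matrix.of fun i j => Function.update v p u j (lam i)) i j := by
      ext i j
      by_cases hj : j = p
      · subst hj
        simp
      · simp [hA, hj]
    rw [h3, Matrix.det_mul_row, ← mul_prod_erase univ _ (mem_univ p)]
    congr 1
    rw [Function.update_self, one_mul]
    exact prod_congr rfl fun j hj => Function.update_of_ne (ne_of_mem_erase hj) _ _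

/-- A transposition moves the marked position `p` to the last place, so all `l + 1` positions
contribute equally. -/
theorem sum_sum_eq_of_perm_invariant {ι K : Type*} [Field K] [Fintype ι] {l : ℕ}
    (X : (Fin (l + 1) → ι) → Fin (l + 1) → K)
    (hX : ∀ (τ : Equiv.Perm (Fin (l + 1))) s p, X (s ∘ τ) p = X s (τ p)) :
    ∑ s, ∑ p, X s p = (l + 1 : K) * ∑ s : Fin l → ι, ∑ q : ι,
      X (Fin.snoc s q : Fin (l + 1) → ι) (Fin.last l) := by
  have h1 : ∀ p, ∑ s, X s p = ∑ s, X s (Fin.last l) := by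
    intro p
    rw [← Equiv.sum_comp (Equiv.arrowCongr (Equiv.swap p (Fin.last l)) (Equiv.refl ι))]
    refine sum_congr rfl fun s _ => ?_
    have : (Equiv.arrowCongr (Equiv.swap p (Fin.last l)) (Equiv.refl ι)) s =
      s ∘ ((Equiv.swap p (Fin.last l))⁻¹ : Equiv.Perm (Fin (l + 1))) := rfl
    rw [this, hX]
    simp
  rw [sum_comm, sum_congr rfl fun p _ => h1 p, sum_const, card_univ, Fintype.card_fin,
    nsmul_eq_mul, Nat.cast_succ]
  congr 1
  rw [← (Fin.snocEquiv fun _ => ι).sum_comp, Fintype.sum_prod_type, sum_comm]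
  rfl

/-! ### Adjoining a variable to a symmetrized product -/

section AltSum

variable {ι K : Type*} [Field K] [DecidableEq ι] [Fintype ι]

/-- The symmetrized product `∑ₛ coef(s) ∏ᵢ f_{s(i)}(lamᵢ)`. -/
def altSum (z : ι → K) (f : ι → ℕ → K) (A : Finset ι) {l : ℕ} (lam : Fin l → ℕ) : K :=
  ∑ s : Fin l → ι, coef z A s * ∏ i, f (s i) (lam i)

/-- Since `coef` alternates in `s`, summing over all reorderings of `s` antisymmetrizes the product
into a determinant. -/
theorem factorial_mul_altSum (z : ι → K) (f : ι → ℕ → K) (A : Finset ι) {l : ℕ}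
    (lam : Fin l → ℕ) :
    (l.factorial : K) * altSum z f A lam =
      ∑ s : Fin l → ι, coef z A s * seqDet (fun j => f (s j)) lam := by
  have h1 : ∀ τ : Equiv.Perm (Fin l), altSum z f A lam =
      ∑ s : Fin l → ι, coef z A s * ((Equiv.Perm.sign τ : ℤ) * ∏ i, f (s i) (lam (τ i))) := by
    intro τ
    rw [altSum, ← Equiv.sum_comp (Equiv.arrowCongr τ (Equiv.refl ι))]
    refine sum_congr rfl fun s _ => ?_
    have : (Equiv.arrowCongr τ (Equiv.refl ι)) s = s ∘ (τ⁻¹ : Equiv.Perm (Fin l)) := rfl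
    rw [this, coef_comp_perm, Equiv.Perm.sign_inv, mul_comm _ (coef z A s), mul_assoc]
    congr 2
    rw [← Equiv.prod_comp τ]
    simp
  have h2 : ∑ _τ : Equiv.Perm (Fin l), altSum z f A lam =
      (l.factorial : K) * altSum z f A lam := by
    simp [Fintype.card_perm]
  rw [← h2, sum_congr rfl fun τ _ => h1 τ, sum_comm]
  refine sum_congr rfl fun s _ => ?_
  rw [← mul_sum, seqDet, Matrix.det_apply']
  rfl

theorem update_snoc_last' {β : Type*} {l : ℕ} (s : Fin l → β) (q k : β) :
    Function.update (Fin.snoc s q : Fin (l + 1) → β) (Fin.last l) k = Fin.snoc s k :=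
  Fin.update_snoc_last (α := fun _ => β) ..

theorem comp_snoc {β γ : Type*} {l : ℕ} (f : β → γ) (s : Fin l → β) (q : β) :
    (fun j => f ((Fin.snoc s q : Fin (l + 1) → β) j)) =
      (Fin.snoc (fun j => f (s j)) (f q) : Fin (l + 1) → γ) := by
  funext j
  refine Fin.lastCases ?_ (fun j => ?_) j <;> simp

/-- The sum over injections of `Fin (l + 1)` into `insert k A`, split according to whether `k` is
attained. -/
theorem sum_coef_insert (z : ι → K) (f : ι → ℕ → K) (A : Finset ι) (k : ι) (hk : k ∉ A) {l : ℕ}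
    (lam : Fin (l + 1) → ℕ) :
    ∑ s : Fin (l + 1) → ι, coef z (insert k A) s * seqDet (fun j => f (s j)) lam =
      (∑ s : Fin (l + 1) → ι, coef z A s * (∏ i, theta z (s i) k) *
        seqDet (fun j => f (s j)) lam) +
      (l + 1 : K) * ∑ s : Fin l → ι, coef z (insert k A) (Fin.snoc s k : Fin (l + 1) → ι) *
        seqDet (Fin.snoc (fun j => f (s j)) (f k)) lam := by
  set D : (Fin (l + 1) → ι) → K := fun s => seqDet (fun j => f (s j)) lam with hD
  -- The sum over `p` marks the position where `s` takes the value `k`, unique when `s` is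
  -- injective.
  have h1 : ∀ s : Fin (l + 1) → ι, coef z (insert k A) s * D s =
      coef z A s * (∏ i, theta z (s i) k) * D s +
      ∑ p, if s p = k then coef z (insert k A) s * D s else 0 := by
    intro s
    by_cases hs : ∀ i, s i ≠ k
    · simp [hs, coef_insert _ _ _ _ hk hs]
    · push Not at hs
      obtain ⟨i, hi⟩ := hs
      have h0 : coef z A s = 0 := if_neg fun h => hk (hi ▸ h.2 i)
      rw [h0, zero_mul, zero_mul, zero_add]
      by_cases hinj : Function.Injective s
      · rw [Fintype.sum_eq_single i fun p hp => if_neg fun h => hp (hinj (h.trans hi.symm)),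
          if_pos hi]
      · have h0 : coef z (insert k A) s = 0 := if_neg fun h => hinj h.1
        simp [h0]
  rw [sum_congr rfl fun s _ => h1 s, sum_add_distrib, sum_sum_eq_of_perm_invariant]
  · congr 2
    refine sum_congr rfl fun s _ => ?_
    simp only [Fin.snoc_last, sum_ite_eq', mem_univ, if_true, hD, comp_snoc f]
  · intro τ s p
    simp only [Function.comp_apply, hD]
    rw [coef_comp_perm, show (fun j => f (s (τ j))) = (fun j => f (s j)) ∘ τ from rfl,
      seqDet_comp_perm]
    have : ((Equiv.Perm.sign τ : ℤ) : K) * ((Equiv.Perm.sign τ : ℤ) : K) = 1 := by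
      rw [← Int.cast_mul, ← Units.val_mul, Int.units_mul_self]; simp
    split_ifs
    · linear_combination coef z (insert k A) s * seqDet (fun j => f (s j)) lam * this
    · rfl

/-- Both sides are expanded into determinants in the columns f. The terms without a forced column
f_k agree at once; the others are multiples of det(f_{s_1}, …, f_{s_l}, f_k), and their coefficients
agree by `prod_theta`. -/
theorem altSum_insert (z : ι → K) (f h : ι → ℕ → K) (A : Finset ι) (k : ι) (hk : k ∉ A)
    (hz : Set.InjOn z (insert k A : Finset ι))
    (hh : ∀ j ∈ A, ∀ r, h j r = theta z j k * f j r - (theta z j k + 1) * f k r) {l : ℕ}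
    (lam : Fin (l + 1) → ℕ) :
    ((l + 1).factorial : K) * altSum z f (insert k A) lam =
      ((l + 1).factorial : K) * altSum z h A lam +
      (l + 1 : K) * ∑ s : Fin l → ι, coef z A s *
        seqDet (Fin.snoc (fun j => h (s j)) (f k)) lam := by
  -- As f_k is already the last column, the f_k parts of the other columns drop out.
  have hsnoc : ∀ s : Fin l → ι, coef z A s * seqDet (Fin.snoc (fun j => h (s j)) (f k)) lam =
      coef z A s * (∏ i, theta z (s i) k) * seqDet (Fin.snoc (fun j => f (s j)) (f k)) lam := by
    intro s
    by_cases hs : ∀ i, s i ∈ A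
    · rw [mul_assoc]
      congr 1
      have := det_add_smul_col (Fin.snoc (fun j => f (s j)) (f k)) (f k)
        (Fin.snoc (fun j => theta z (s j) k) 1) (Fin.snoc (fun j => -(theta z (s j) k + 1)) 0) lam
      rw [Fin.sum_univ_castSucc, Fin.prod_univ_castSucc] at this
      simp only [Fin.snoc_castSucc, Fin.snoc_last, zero_mul, add_zero, mul_one] at this
      rw [sum_eq_zero, add_zero] at this
      · rw [← this]
        congr 1
        funext j r
        refine Fin.lastCases ?_ (fun j => ?_) j
        · simp
        · simp [hh _ (hs j)]
          ring
      · intro p _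
        refine mul_eq_zero_of_right _ ?_
        refine Matrix.det_zero_of_column_eq (Fin.castSucc_lt_last p).ne fun i => ?_
        simp [Function.update_of_ne (Fin.castSucc_lt_last p).ne']
    · have h0 : coef z A s = 0 := if_neg fun h => hs h.2
      simp [h0]
  set D : (Fin (l + 1) → ι) → K := fun s => seqDet (fun j => f (s j)) lam with hD
  -- At most one column can contribute its f_k part; `p` is its position.
  have hexp : ∀ s : Fin (l + 1) → ι, coef z A s * seqDet (fun j => h (s j)) lam =
      coef z A s * (∏ i, theta z (s i) k) * D s +
      ∑ p, coef z A s * (-(theta z (s p) k + 1) * (∏ j ∈ univ.erase p, theta z (s j) k) *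
        D (Function.update s p k)) := by
    intro s
    by_cases hs : ∀ i, s i ∈ A
    · have := det_add_smul_col (fun j => f (s j)) (f k)
        (fun j => theta z (s j) k) (fun j => -(theta z (s j) k + 1)) lam
      rw [← mul_sum, mul_assoc, ← mul_add]
      congr 1
      rw [hD]
      convert! this using 1
      · congr 1
        funext j r
        rw [hh _ (hs j)]
        ring
      · congr 1
        refine sum_congr rfl fun p _ => ?_
        congr 1
        change seqDet _ _ = seqDet _ _
        congr 1
        funext j
        by_cases hj : j = p
        · subst hj
          simp
        · simp [hj]
    · have h0 : coef z A s = 0 := if_neg fun h => hs h.2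
      simp [h0]
  rw [factorial_mul_altSum, factorial_mul_altSum, sum_coef_insert _ _ _ _ hk,
    sum_congr rfl fun s _ => hexp s, sum_add_distrib, add_assoc, sum_congr rfl fun s _ => hsnoc s]
  congr 1
  -- The replaced column is moved to the last place; below, `q` is the index that stood there before
  -- the replacement.
  rw [sum_sum_eq_of_perm_invariant, ← mul_add, ← sum_add_distrib]
  · congr 1
    refine sum_congr rfl fun s _ => ?_
    simp only [Fin.snoc_last, update_snoc_last', hD, comp_snoc f]
    have herase : ∀ q : ι, ∏ j ∈ univ.erase (Fin.last l),
        theta z ((Fin.snoc s q : Fin (l + 1) → ι) j) k = ∏ j, theta z (s j) k := by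
      intro q
      have : (univ.erase (Fin.last l)) = univ.map (Fin.castSuccEmb) := by
        ext j
        refine Fin.lastCases ?_ (fun j => ?_) j <;> simp [(Fin.castSucc_lt_last _).ne]
      rw [this, prod_map]
      simp
    simp only [herase]
    rw [coef_snoc_insert _ _ _ _ hk]
    by_cases hs : Function.Injective s ∧ ∀ i, s i ∈ A
    · have hq : ∑ q, coef z A (Fin.snoc s q : Fin (l + 1) → ι) *
          (-(theta z q k + 1) * (∏ j, theta z (s j) k) *
            seqDet (Fin.snoc (fun j => f (s j)) (f k)) lam) =
          ∑ q ∈ A \ univ.image s, coef z A s * (∏ m ∈ (A \ univ.image s).erase q, theta z q m) *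
          (-(theta z q k + 1) * (∏ j, theta z (s j) k) *
            seqDet (Fin.snoc (fun j => f (s j)) (f k)) lam) := by
        symm
        rw [← sum_subset (subset_univ (A \ univ.image s))]
        · refine sum_congr rfl fun q hq => ?_
          simp only [mem_sdiff, mem_image, mem_univ, true_and, not_exists] at hq
          rw [coef_snoc_of_mem _ _ _ _ hq.1 hq.2]
        · intro q _ hq
          refine mul_eq_zero_of_left (if_neg fun h => hq ?_) _
          rw [Fin.snoc_injective_iff, Fin.forall_fin_succ'] at h
          simp only [Fin.snoc_last] at h
          simp only [mem_sdiff, mem_image, mem_univ, true_and]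
          exact ⟨h.2.2, h.1.2⟩
      rw [hq, prod_theta z k (A \ univ.image s)
        (hz.mono (by gcongr; exact sdiff_subset)) (by simp [hk]), mul_sub, mul_sum, sub_mul,
        sum_mul, sub_eq_add_neg, add_comm, ← sum_neg_distrib, mul_one]
      congr 1
      refine sum_congr rfl fun q _ => ?_
      ring
    · have h0 : coef z A s = 0 := if_neg hs
      have h0' : ∀ q, coef z A (Fin.snoc s q : Fin (l + 1) → ι) = 0 := fun q => if_neg fun h =>
        hs ⟨(Fin.snoc_injective_iff.1 h.1).1, fun i => by
          simpa using h.2 i.castSucc⟩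
      simp [h0, h0']
  · intro τ s p
    have h1 : Function.update (s ∘ τ) p k = Function.update s (τ p) k ∘ τ := by
      funext j
      by_cases hj : j = p <;> simp [hj]
    have h2 : ∏ j ∈ univ.erase p, theta z ((s ∘ τ) j) k =
        ∏ j ∈ univ.erase (τ p), theta z (s j) k := by
      refine prod_bij (fun j _ => τ j) ?_ ?_ ?_ ?_
      · intro j hj; simpa using hj
      · intro j _ j' _ h; exact τ.injective h
      · intro j hj; exact ⟨τ.symm j, by simpa [Equiv.symm_apply_eq] using hj, by simp⟩
      · intro j _; rfl
    rw [h1, h2, coef_comp_perm]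
    simp only [hD]
    rw [show (fun j => f ((Function.update s (τ p) k ∘ τ) j)) =
      (fun j => f (Function.update s (τ p) k j)) ∘ τ from rfl, seqDet_comp_perm]
    have : ((Equiv.Perm.sign τ : ℤ) : K) * ((Equiv.Perm.sign τ : ℤ) : K) = 1 := by
      rw [← Int.cast_mul, ← Units.val_mul, Int.units_mul_self]; simp
    simp only [Function.comp_apply]
    linear_combination coef z A s * (-(theta z (s (τ p)) k + 1) *
      (∏ j ∈ univ.erase (τ p), theta z (s j) k) *
      seqDet (fun j => f (Function.update s (τ p) k j)) lam) * this

end AltSum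
/-! ### One-particle operators -/

section OneParticle

variable {K : Type*} [Field K]

/-- The one-particle transfer operator of a primed letter of weight `y`. -/
def vertOp (a : ℕ → K) (y : K) (v : ℕ → K) : ℕ → K
  | 0 => v 0
  | r + 1 => v (r + 1) + (y - a r) * v r

/-- The one-particle transfer operator of an unprimed letter of weight `y`. -/
def horOp (a : ℕ → K) (y : K) (v : ℕ → K) : ℕ → K
  | 0 => v 0
  | r + 1 => v (r + 1) + (y + a r) * horOp a y v r

/-- The one-particle transfer operator of a primed letter followed by an unprimed letter. -/
def stepOp (a : ℕ → K) (y : K) (v : ℕ → K) : ℕ → K := horOp a y (vertOp a y v)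

/-- The one-particle transfer operator of the four letters with a common index. -/
def blockOp (a : ℕ → K) (x : K) (v : ℕ → K) : ℕ → K := stepOp a x⁻¹ (stepOp a x v)

theorem stepOp_zero (a : ℕ → K) (y : K) (v : ℕ → K) : stepOp a y v 0 = v 0 := by
  rw [stepOp, horOp, vertOp]

theorem stepOp_succ (a : ℕ → K) (y : K) (v : ℕ → K) (r : ℕ) :
    stepOp a y v (r + 1) = v (r + 1) + (y - a r) * v r + (y + a r) * stepOp a y v r := by
  rw [stepOp, horOp, vertOp]

theorem stepOp_lin (a : ℕ → K) (y c d : K) (v w : ℕ → K) :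
    stepOp a y (fun r => c * v r + d * w r) =
      fun r => c * stepOp a y v r + d * stepOp a y w r := by
  funext r
  induction r with
  | zero => simp only [stepOp_zero]
  | succ r ih =>
    simp only [stepOp_succ, ih]
    ring

theorem facMonomial_succ (a : ℕ → K) (x : K) (r : ℕ) :
    facMonomial a x (r + 1) = facMonomial a x r * (x + a r) := prod_range_succ _ _

/-- The monomials in x form an eigenvector modulo those in y. The second coefficient is forced by
the value 1 at `r = 0`, which `stepOp` preserves. -/
theorem stepOp_facMonomial (a : ℕ → K) (x y : K) (hxy : x ≠ y) :
    stepOp a y (facMonomial a x) = fun r => (x + y) / (x - y) * facMonomial a x r +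
      (1 - (x + y) / (x - y)) * facMonomial a y r := by
  have h : x - y ≠ 0 := sub_ne_zero.2 hxy
  funext r
  induction r with
  | zero => simp [stepOp_zero, facMonomial]
  | succ r ih =>
    simp only [stepOp_succ, ih, facMonomial_succ]
    field_simp
    ring

/-- The sequence `1, 0, 0, …`. -/
def unitSeq : ℕ → K := fun r => if r = 0 then 1 else 0

/-- At `r = 1` the operator yields (y - a₀) + (y + a₀) = 2y, while the right side is 2(y + a₀): here
`a 0 = 0` enters. -/
theorem stepOp_unitSeq (a : ℕ → K) (ha : a 0 = 0) (y : K) :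
    stepOp a y unitSeq = fun r => 2 * facMonomial a y r + (-1) * unitSeq r := by
  funext r
  induction r with
  | zero => norm_num [stepOp_zero, facMonomial, unitSeq]
  | succ r ih =>
    simp only [stepOp_succ, ih, facMonomial_succ]
    rcases r with _ | r
    · simp [unitSeq, facMonomial, ha]
      ring
    · simp [unitSeq]
      ring

/-- The function `Q_{(r)}` in one variable. -/
def oneRow (a : ℕ → K) (x : K) (r : ℕ) : K :=
  2 * ((x ^ 2 + 1) / (x ^ 2 - 1)) * facMonomial a x r +
    -(2 * ((x ^ 2 + 1) / (x ^ 2 - 1))) * facMonomial a x⁻¹ r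

theorem oneRow_zero (a : ℕ → K) (x : K) : oneRow a x 0 = 0 := by
  simp [oneRow, facMonomial]

theorem ne_inv_of_mul_ne_one {x y : K} (hxy : x * y ≠ 1) (hy : y ≠ 0) : x ≠ y⁻¹ := by
  rintro rfl
  exact hxy (inv_mul_cancel₀ hy)

/-- With θ = (x + x⁻¹)/(x - x⁻¹), the monomials in x⁻¹ get 2(1 - θ) from the image of those in x and
-2 from the image of `unitSeq`, in total -2θ. This is the origin of `oneRow`. -/
theorem blockOp_unitSeq (a : ℕ → K) (ha : a 0 = 0) (x : K) (hx : x ≠ 0) (hx2 : x ^ 2 ≠ 1) :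
    blockOp a x unitSeq = fun r => unitSeq r + oneRow a x r := by
  have h : x ^ 2 - 1 ≠ 0 := sub_ne_zero.2 hx2
  have h' : x - x⁻¹ ≠ 0 := sub_ne_zero.2 (ne_inv_of_mul_ne_one (by rwa [← sq]) hx)
  have h1 : (x + x⁻¹) / (x - x⁻¹) = (x ^ 2 + 1) / (x ^ 2 - 1) := by
    rw [div_eq_div_iff h' h]
    field_simp
  rw [blockOp, stepOp_unitSeq a ha, stepOp_lin, stepOp_unitSeq a ha,
    stepOp_facMonomial a _ _ (sub_ne_zero.1 h'), h1]
  funext r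
  simp only [oneRow]
  ring

/-- The steps y and y⁻¹ multiply the monomials in x by (x + y)/(x - y) · (xy + 1)/(xy - 1), which is
the cross ratio of x + x⁻¹ and y + y⁻¹. It is unchanged under x ↦ x⁻¹, so `oneRow a x` is an
eigenvector modulo `oneRow a y`. -/
theorem blockOp_oneRow (a : ℕ → K) (x y : K) (hx : x ≠ 0) (hy : y ≠ 0) (hx2 : x ^ 2 ≠ 1)
    (hy2 : y ^ 2 ≠ 1) (hxy : x ≠ y) (hxy1 : x * y ≠ 1) (r : ℕ) :
    blockOp a y (oneRow a x) r =
      ((x + x⁻¹) + (y + y⁻¹)) / ((x + x⁻¹) - (y + y⁻¹)) * oneRow a x r -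
      (((x + x⁻¹) + (y + y⁻¹)) / ((x + x⁻¹) - (y + y⁻¹)) + 1) * oneRow a y r := by
  have n1 : x ≠ y⁻¹ := ne_inv_of_mul_ne_one hxy1 hy
  have n2 : x⁻¹ ≠ y := (ne_inv_of_mul_ne_one (by rwa [mul_comm]) hx).symm
  have n3 : x⁻¹ ≠ y⁻¹ := fun h => hxy (inv_injective h)
  have n4 : y ≠ y⁻¹ := ne_inv_of_mul_ne_one (by rwa [← sq]) hy
  have e1 : oneRow a x = fun r => 2 * ((x ^ 2 + 1) / (x ^ 2 - 1)) * facMonomial a x r +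
    -(2 * ((x ^ 2 + 1) / (x ^ 2 - 1))) * facMonomial a x⁻¹ r := rfl
  rw [blockOp, e1, stepOp_lin, stepOp_facMonomial a _ _ hxy, stepOp_facMonomial a _ _ n2,
    stepOp_lin, stepOp_lin, stepOp_lin, stepOp_facMonomial a _ _ n1, stepOp_facMonomial a _ _ n3,
    stepOp_facMonomial a _ _ n4]
  simp only [oneRow]
  generalize facMonomial a x r = P
  generalize facMonomial a x⁻¹ r = P'
  generalize facMonomial a y r = Q
  generalize facMonomial a y⁻¹ r = Q'
  have d1 : x ^ 2 - 1 ≠ 0 := sub_ne_zero.2 hx2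
  have d2 : y ^ 2 - 1 ≠ 0 := sub_ne_zero.2 hy2
  have d3 : x - y ≠ 0 := sub_ne_zero.2 hxy
  have d4 : x * y - 1 ≠ 0 := sub_ne_zero.2 hxy1
  have t1 : (x + y⁻¹) / (x - y⁻¹) = (x * y + 1) / (x * y - 1) := by
    rw [div_eq_div_iff (sub_ne_zero.2 n1) d4]; field_simp
  have t2 : (x⁻¹ + y) / (x⁻¹ - y) = -((x * y + 1) / (x * y - 1)) := by
    rw [← neg_div, div_eq_div_iff (sub_ne_zero.2 n2) d4]; field_simp; ring
  have t3 : (x⁻¹ + y⁻¹) / (x⁻¹ - y⁻¹) = -((x + y) / (x - y)) := by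
    rw [← neg_div, div_eq_div_iff (sub_ne_zero.2 n3) d3]; field_simp; ring
  have t4 : (y + y⁻¹) / (y - y⁻¹) = (y ^ 2 + 1) / (y ^ 2 - 1) := by
    rw [div_eq_div_iff (sub_ne_zero.2 n4) d2]; field_simp
  have d5 : (x + x⁻¹) - (y + y⁻¹) ≠ 0 := by
    have : (x + x⁻¹) - (y + y⁻¹) = (x - y) * (x * y - 1) / (x * y) := by field_simp; ring
    rw [this]
    exact div_ne_zero (mul_ne_zero d3 d4) (mul_ne_zero hx hy)
  have t5 : ((x + x⁻¹) + (y + y⁻¹)) / ((x + x⁻¹) - (y + y⁻¹)) =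
      (x + y) / (x - y) * ((x * y + 1) / (x * y - 1)) := by
    rw [div_mul_div_comm, div_eq_div_iff d5 (mul_ne_zero d3 d4)]; field_simp; ring
  rw [t1, t2, t3, t4, t5]
  field_simp
  ring

end OneParticle
/-! ### Transfer of determinants along strips -/

section Strips

/-- The strictly decreasing sequences `mu` such that `lam / mu` is a vertical strip. -/
def vertStrips {l : ℕ} (lam : Fin l → ℕ) : Finset (Fin l → ℕ) :=
  open Classical in
  {mu ∈ Fintype.piFinset fun i => Iic (lam i) | StrictAnti mu ∧ ∀ i, lam i ≤ mu i + 1}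

/-- The strictly decreasing sequences `mu` such that `lam / mu` is a horizontal strip. -/
def horStrips {l : ℕ} (lam : Fin l → ℕ) : Finset (Fin l → ℕ) :=
  open Classical in
  {mu ∈ Fintype.piFinset fun i => Iic (lam i) | StrictAnti mu ∧ ∀ i j, i < j → lam j < mu i}

theorem mem_vertStrips {l : ℕ} {lam mu : Fin l → ℕ} :
    mu ∈ vertStrips lam ↔ (∀ i, mu i ≤ lam i) ∧ StrictAnti mu ∧ ∀ i, lam i ≤ mu i + 1 := by
  simp [vertStrips, Fintype.mem_piFinset]

theorem mem_horStrips {l : ℕ} {lam mu : Fin l → ℕ} :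
    mu ∈ horStrips lam ↔
      (∀ i, mu i ≤ lam i) ∧ StrictAnti mu ∧ ∀ i j, i < j → lam j < mu i := by
  simp [horStrips, Fintype.mem_piFinset]

variable {K : Type*} [Field K]

theorem det_sum_rows {l : ℕ} (v : Fin l → ℕ → K) (S : Fin l → Finset ℕ) (c : Fin l → ℕ → K) :
    (Matrix.of fun i j => ∑ m ∈ S i, c i m * v j m).det =
      ∑ mu ∈ Fintype.piFinset S, (∏ i, c i (mu i)) * seqDet v mu := by
  have h := (Matrix.detRowAlternating (n := Fin l) (R := K)).toMultilinearMap.map_sum_finset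
    (fun i m => c i m • fun j => v j m) S
  simp only [AlternatingMap.coe_multilinearMap] at h
  rw [Matrix.det, show (Matrix.of fun i j => ∑ m ∈ S i, c i m * v j m) =
    fun i => ∑ m ∈ S i, c i m • fun j => v j m by
      funext i j; simp [Finset.sum_apply], h]
  refine sum_congr rfl fun mu _ => ?_
  have := (Matrix.detRowAlternating (n := Fin l) (R := K)).toMultilinearMap.map_smul_univ
    (fun i => c i (mu i)) (fun i j => v j (mu i))
  simp only [AlternatingMap.coe_multilinearMap, smul_eq_mul] at this
  exact this

theorem vertOp_eq_sum (a : ℕ → K) (y : K) (v : ℕ → K) (r : ℕ) :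
    vertOp a y v r = ∑ m ∈ Icc (r - 1) r, (∏ d ∈ Ico m r, (y - a d)) * v m := by
  rcases r with _ | r
  · simp [vertOp]
  · have : Icc r (r + 1) = {r, r + 1} := by
      ext m
      simp only [mem_Icc, mem_insert, mem_singleton]
      omega
    rw [Nat.add_sub_cancel, this, sum_pair (by omega)]
    simp [vertOp, add_comm]

/-- Row expansion lets each mu_i be lam_i or lam_i - 1. For strict `lam`, strictness of `mu` can
fail only through two equal entries, and then the determinant has equal rows. -/
theorem seqDet_vertOp (a : ℕ → K) (y : K) {l : ℕ} (v : Fin l → ℕ → K) (lam : Fin l → ℕ)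
    (hlam : StrictAnti lam) :
    seqDet (fun j => vertOp a y (v j)) lam =
      ∑ mu ∈ vertStrips lam, (∏ i, ∏ d ∈ Ico (mu i) (lam i), (y - a d)) * seqDet v mu := by
  rw [seqDet]
  simp only [vertOp_eq_sum]
  rw [det_sum_rows v (fun i => Icc (lam i - 1) (lam i))
    (fun i m => ∏ d ∈ Ico m (lam i), (y - a d))]
  symm
  apply sum_subset
  · intro mu hmu
    rw [mem_vertStrips] at hmu
    simp only [Fintype.mem_piFinset, mem_Icc]
    intro i
    have := hmu.1 i
    have := hmu.2.2 i
    omega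
  · intro mu hmu hmu'
    simp only [Fintype.mem_piFinset, mem_Icc] at hmu
    have h : ¬ StrictAnti mu := fun h => hmu' (mem_vertStrips.2
      ⟨fun i => (hmu i).2, h, fun i => by have := (hmu i).1; omega⟩)
    simp only [StrictAnti, not_forall] at h
    obtain ⟨i, j, hij, h⟩ := h
    refine mul_eq_zero_of_right _ (Matrix.det_zero_of_row_eq hij.ne ?_)
    have h1 := hlam hij
    have h2 := hmu i
    have h3 := hmu j
    have : mu i = mu j := by omega
    funext k
    simp [this]

theorem horOp_eq_sum_add (a : ℕ → K) (y : K) (v : ℕ → K) {s r : ℕ} (h : s ≤ r) :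
    horOp a y v r = (∑ m ∈ Ioc s r, (∏ d ∈ Ico m r, (y + a d)) * v m) +
      (∏ d ∈ Ico s r, (y + a d)) * horOp a y v s := by
  induction r, h using Nat.le_induction with
  | base => simp
  | succ r h ih =>
    rw [horOp, ih, sum_Ioc_succ_top h, prod_Ico_succ_top h, Ico_self, prod_empty]
    have : ∑ m ∈ Ioc s r, (∏ d ∈ Ico m (r + 1), (y + a d)) * v m =
        (y + a r) * ∑ m ∈ Ioc s r, (∏ d ∈ Ico m r, (y + a d)) * v m := by
      rw [mul_sum]
      refine sum_congr rfl fun m hm => ?_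
      rw [prod_Ico_succ_top (mem_Ioc.1 hm).2]
      ring
    rw [this]
    ring

theorem horOp_eq_sum (a : ℕ → K) (y : K) (v : ℕ → K) (r : ℕ) :
    horOp a y v r = ∑ m ∈ Iic r, (∏ d ∈ Ico m r, (y + a d)) * v m := by
  have h : Iic r = insert 0 (Ioc 0 r) := by
    ext m
    simp only [mem_Iic, mem_insert, mem_Ioc]
    omega
  rw [horOp_eq_sum_add a y v (Nat.zero_le r), h, sum_insert (by simp), horOp, add_comm]

/-- Row i of the matrix involves all m ≤ lam_i. Subtracting a multiple of row i + 1 cuts this down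
to lam_{i+1} < m ≤ lam_i, which is the horizontal strip condition. -/
theorem seqDet_horOp (a : ℕ → K) (y : K) {l : ℕ} (v : Fin l → ℕ → K) (lam : Fin l → ℕ)
    (hlam : StrictAnti lam) :
    seqDet (fun j => horOp a y (v j)) lam =
      ∑ mu ∈ horStrips lam, (∏ i, ∏ d ∈ Ico (mu i) (lam i), (y + a d)) * seqDet v mu := by
  set S : Fin l → Finset ℕ := fun i => {m ∈ Iic (lam i) | ∀ j, i < j → lam j < m} with hS
  have hrow : seqDet (fun j => horOp a y (v j)) lam = (Matrix.of fun i j =>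
      ∑ m ∈ S i, (∏ d ∈ Ico m (lam i), (y + a d)) * v j m).det := by
    rcases l with _ | l
    · simp [seqDet]
    -- The rows are reversed because the determinant lemma subtracts from each row its predecessor.
    · rw [seqDet, ← Matrix.det_submatrix_equiv_self Fin.revPerm,
        ← Matrix.det_submatrix_equiv_self Fin.revPerm (Matrix.of fun i j =>
          ∑ m ∈ S i, (∏ d ∈ Ico m (lam i), (y + a d)) * v j m)]
      refine Matrix.det_eq_of_forall_row_eq_smul_add_pred
        (fun i => ∏ d ∈ Ico (lam i.rev.succ) (lam i.rev.castSucc), (y + a d)) (fun j => ?_)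
        (fun i j => ?_)
      · have : S (Fin.last l) = Iic (lam (Fin.last l)) := by
          rw [hS]
          exact filter_true_of_mem fun m _ j hj => absurd hj (Fin.le_last j).not_gt
        simp [this, horOp_eq_sum]
      · have : S i.rev.castSucc = Ioc (lam i.rev.succ) (lam i.rev.castSucc) := by
          ext m
          simp only [hS, mem_filter, mem_Iic, mem_Ioc]
          constructor
          · exact fun h => ⟨h.2 _ Fin.castSucc_lt_succ, h.1⟩
          · refine fun h => ⟨h.2, fun j hj => lt_of_le_of_lt (hlam.antitone ?_) h.1⟩
            exact Fin.castSucc_lt_iff_succ_le.1 hj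
        simp only [Matrix.submatrix_apply, Matrix.of_apply, Fin.revPerm_apply, Fin.rev_succ,
          Fin.rev_castSucc, this]
        exact horOp_eq_sum_add _ _ _ (hlam Fin.castSucc_lt_succ).le
  rw [hrow, det_sum_rows v S (fun i m => ∏ d ∈ Ico m (lam i), (y + a d))]
  refine sum_congr ?_ fun _ _ => rfl
  ext mu
  simp only [mem_horStrips, Fintype.mem_piFinset, hS, mem_filter, mem_Iic]
  constructor
  · intro h
    exact ⟨fun i => (h i).1, fun i j hij => lt_of_le_of_lt (h j).1 ((h i).2 j hij),
      fun i j hij => (h i).2 j hij⟩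
  · exact fun h i => ⟨h.1 i, fun j hij => h.2.2 i j hij⟩

end Strips
/-! ### Fillings of shifted diagrams -/

section Fillings

variable {N : ℕ}

theorem Letter.rank_injective : Function.Injective (Letter.rank (n := N)) := by
  intro s t h
  cases s <;> cases t <;> simp only [Letter.rank] at h <;>
    first
    | (exfalso; omega)
    | (congr 1; apply Fin.ext; omega)

theorem Letter.index_lt_iff (t : Letter N) (k : ℕ) : (t.index : ℕ) < k ↔ t.rank < 4 * k := by
  cases t <;> simp only [Letter.rank, Letter.index] <;> omega

/-- The tableau conditions for a filling of a shifted diagram with an arbitrary number of rows. -/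
structure IsFilling {l : ℕ} {lam : Fin l → ℕ} (T : Cell lam → Letter N) : Prop where
  row_weak : ∀ c d, Cell.row c = Cell.row d → Cell.col c ≤ Cell.col d → (T c).rank ≤ (T d).rank
  col_weak : ∀ c d, Cell.col c = Cell.col d → Cell.row c ≤ Cell.row d → (T c).rank ≤ (T d).rank
  row_primed : ∀ c d, Cell.row c = Cell.row d → T c = T d → (T c).IsPrimed → c = d
  col_unprimed : ∀ c d, Cell.col c = Cell.col d → T c = T d → ¬ (T c).IsPrimed → c = d
  diag : ∀ c d, Cell.content c = 0 → Cell.content d = 0 → (T c).index = (T d).index → c = d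

/-- The fillings of `lam` whose letters satisfy a predicate on row, content and letter. -/
def fillings {l : ℕ} (lam : Fin l → ℕ) (P : ℕ → ℕ → Letter N → Prop) :
    Finset (Cell lam → Letter N) :=
  open Classical in {T | IsFilling T ∧ ∀ c, P (Cell.row c) (Cell.content c) (T c)}

theorem mem_fillings {l : ℕ} {lam : Fin l → ℕ} {P : ℕ → ℕ → Letter N → Prop}
    {T : Cell lam → Letter N} :
    T ∈ fillings lam P ↔ IsFilling T ∧ ∀ c, P (Cell.row c) (Cell.content c) (T c) := by
  simp [fillings]

/-- The weighted count of `fillings lam P`. -/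
def fillingSum {K : Type*} [Field K] (a : ℕ → K) (x : Fin N → K) {l : ℕ} (lam : Fin l → ℕ)
    (P : ℕ → ℕ → Letter N → Prop) : K :=
  ∑ T ∈ fillings lam P, ∏ c, letterWeight a x (Cell.content c) (T c)

/-- lam_i + i is the first column to the right of row i. Hence a column that meets row j also meets
row i ≤ j, provided it lies at or right of the diagonal there. -/
theorem strictAnti_add_le {l : ℕ} {lam : Fin l → ℕ} (h : StrictAnti lam) {i j : Fin l}
    (hij : i ≤ j) : lam j + (j : ℕ) ≤ lam i + (i : ℕ) := by
  rcases l with _ | l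
  · exact i.elim0
  · have : Antitone fun i : Fin (l + 1) => lam i + (i : ℕ) := by
      rw [Fin.antitone_iff_succ_le]
      intro i
      have := h (Fin.castSucc_lt_succ (i := i))
      simp only [Fin.val_succ, Fin.val_castSucc]
      omega
    exact this hij

/-- The number of cells in each row which carry a letter of rank less than `r`. -/
def shapeBelow {l : ℕ} {lam : Fin l → ℕ} (T : Cell lam → Letter N) (r : ℕ) (i : Fin l) : ℕ :=
  open Classical in
  Nat.find (p := fun d => ∀ h : d < lam i, ¬ (T ⟨i, ⟨d, h⟩⟩).rank < r)
    ⟨lam i, fun h => absurd h (lt_irrefl _)⟩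

theorem shapeBelow_le {l : ℕ} {lam : Fin l → ℕ} (T : Cell lam → Letter N) (r : ℕ) (i : Fin l) :
    shapeBelow T r i ≤ lam i := by
  classical
  exact Nat.find_min' _ fun h => absurd h (lt_irrefl _)

theorem lt_shapeBelow {l : ℕ} {lam : Fin l → ℕ} {T : Cell lam → Letter N} (hT : IsFilling T)
    (r : ℕ) (i : Fin l) (d : ℕ) (h : d < lam i) :
    d < shapeBelow T r i ↔ (T ⟨i, ⟨d, h⟩⟩).rank < r := by
  classical
  constructor
  · intro hd
    have := Nat.find_min _ hd
    simp only [not_forall, not_not] at this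
    exact this.2
  · intro hr
    by_contra hd
    push Not at hd
    have h1 := Nat.find_spec (p := fun d => ∀ h : d < lam i, ¬ (T ⟨i, ⟨d, h⟩⟩).rank < r)
      ⟨lam i, fun h => absurd h (lt_irrefl _)⟩
    have h2 : shapeBelow T r i < lam i := lt_of_le_of_lt hd h
    refine h1 h2 (lt_of_le_of_lt (hT.row_weak ⟨i, ⟨shapeBelow T r i, h2⟩⟩ ⟨i, ⟨d, h⟩⟩ rfl ?_) hr)
    simp only [Cell.col, Cell.row, Cell.content]
    omega

theorem shapeBelow_eq {l : ℕ} {lam mu : Fin l → ℕ} {T : Cell lam → Letter N} (hT : IsFilling T)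
    (r : ℕ) (hmu : ∀ i, mu i ≤ lam i)
    (h : ∀ i d (h : d < lam i), d < mu i ↔ (T ⟨i, ⟨d, h⟩⟩).rank < r) :
    shapeBelow T r = mu := by
  funext i
  have h1 := shapeBelow_le T r i
  have h2 := hmu i
  by_contra hne
  rcases Nat.lt_or_gt_of_ne hne with hlt | hlt
  · have := (h i _ (by omega)).1 hlt
    rw [← lt_shapeBelow hT] at this
    omega
  · have := (lt_shapeBelow hT r i _ (by omega)).1 hlt
    rw [← h] at this
    omega

/-- The sequences obtained by removing from `lam` the cells which carry a given largest letter. -/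
def strips : Letter N → ∀ {l : ℕ}, (Fin l → ℕ) → Finset (Fin l → ℕ)
  | .primed _, _, lam => vertStrips lam
  | .plain _, _, lam => horStrips lam
  | .barPrimed _, _, lam => vertStrips lam
  | .bar _, _, lam => horStrips lam

theorem mem_strips (t : Letter N) {l : ℕ} {lam mu : Fin l → ℕ} :
    mu ∈ strips t lam ↔ (∀ i, mu i ≤ lam i) ∧ StrictAnti mu ∧
      (t.IsPrimed → ∀ i, lam i ≤ mu i + 1) ∧ (¬ t.IsPrimed → ∀ i j, i < j → lam j < mu i) := by
  cases t <;> simp [strips, Letter.IsPrimed, mem_vertStrips, mem_horStrips]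

/-- The condition that the letter `t` at row `i` and content `d` has rank less than `r`, and that
on the diagonal it has index less than `k` precisely in the first `l` rows. -/
def BlockPred (l k r : ℕ) (i d : ℕ) (t : Letter N) : Prop :=
  t.rank < r ∧ (d = 0 → (i < l ↔ (t.index : ℕ) < k))

theorem four_mul_index_le_rank (t : Letter N) : 4 * (t.index : ℕ) ≤ t.rank := by
  cases t <;> simp only [Letter.rank, Letter.index] <;> omega

/-- The strip conditions say that a primed letter is not repeated in a row and an unprimed one not
in a column. Strictness holds because the entry above a remaining cell is no larger, hence remains
too. -/
theorem shapeBelow_mem_strips {l : ℕ} {lam : Fin (l + 1) → ℕ} (hlam : StrictAnti lam)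
    (t : Letter N) {T : Cell lam → Letter N}
    (hT : T ∈ fillings lam (BlockPred l t.index (t.rank + 1))) :
    shapeBelow T t.rank ∈ strips t lam := by
  rw [mem_fillings] at hT
  obtain ⟨hT, hP⟩ := hT
  set mu := shapeBelow T t.rank with hmu
  have hle := shapeBelow_le T t.rank
  have hlt := lt_shapeBelow hT t.rank
  rw [← hmu] at hle hlt
  have heq : ∀ i d (h : d < lam i), mu i ≤ d → T ⟨i, ⟨d, h⟩⟩ = t := by
    intro i d h hd
    apply Letter.rank_injective
    have h1 := (hlt i d h).not.1 (by omega)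
    have h2 := (hP ⟨i, ⟨d, h⟩⟩).1
    omega
  -- Rows above the last start with an index smaller than that of `t`, so removing `t` never empties
  -- them.
  have hpos : ∀ i j : Fin (l + 1), i < j → 0 < mu i := by
    intro i j hij
    have h0 : 0 < lam i := lt_of_le_of_lt (Nat.zero_le _) (hlam hij)
    rw [hlt i 0 h0]
    have h1 := ((hP ⟨i, ⟨0, h0⟩⟩).2 rfl).1 (by
      simp only [Cell.row]
      have := j.2
      have : (i : ℕ) < j := hij
      omega)
    rw [Letter.index_lt_iff] at h1
    have := four_mul_index_le_rank t
    omega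
  rw [mem_strips]
  refine ⟨hle, ?_, ?_, ?_⟩
  · intro i j hij
    have h0 := hpos i j hij
    rcases Nat.eq_zero_or_pos (mu j) with hj | hj
    · omega
    · have hij' : (i : ℕ) < j := hij
      have h1 := strictAnti_add_le hlam hij.le
      have h2 := hle j
      have he : mu j - 1 + (j - i) < lam i := by omega
      have h3 := (hlt j (mu j - 1) (by omega)).1 (by omega)
      have h4 := hT.col_weak ⟨i, ⟨mu j - 1 + (j - i), he⟩⟩ ⟨j, ⟨mu j - 1, by omega⟩⟩
        (by simp only [Cell.col, Cell.row, Cell.content]; omega) hij'.le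
      have h5 := (hlt i _ he).2 (lt_of_le_of_lt h4 h3)
      omega
  · intro ht i
    by_contra hc
    push Not at hc
    have h1 := heq i (mu i) (by omega) le_rfl
    have h2 := heq i (mu i + 1) (by omega) (by omega)
    have h3 := hT.row_primed ⟨i, ⟨mu i, by omega⟩⟩ ⟨i, ⟨mu i + 1, by omega⟩⟩ rfl (by rw [h1, h2])
      (by rwa [h1])
    simp at h3
  · intro ht i j hij
    by_contra hc
    push Not at hc
    have h0 := hpos i j hij
    have hij' : (i : ℕ) < j := hij
    have h1 := strictAnti_add_le hlam hij.le
    have he : lam j - 1 + (j - i) < lam i := by omega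
    have h2 := heq i _ he (by omega)
    have hcol : Cell.col (⟨i, ⟨lam j - 1 + (j - i), he⟩⟩ : Cell lam) =
        Cell.col (⟨j, ⟨lam j - 1, by omega⟩⟩ : Cell lam) := by
      simp only [Cell.col, Cell.row, Cell.content]; omega
    have h3 := hT.col_weak _ _ hcol hij'.le
    have h4 : T ⟨j, ⟨lam j - 1, by omega⟩⟩ = t := by
      apply Letter.rank_injective
      have := (hP ⟨j, ⟨lam j - 1, by omega⟩⟩).1
      rw [h2] at h3
      omega
    have h5 := hT.col_unprimed _ _ hcol (by rw [h2, h4]) (by rwa [h2])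
    have := congrArg Sigma.fst h5
    exact hij.ne this

/-- The restriction of a filling to a smaller shape. -/
def restrictFilling {l : ℕ} {lam mu : Fin l → ℕ} (h : ∀ i, mu i ≤ lam i)
    (T : Cell lam → Letter N) : Cell mu → Letter N :=
  fun c => T ⟨c.1, Fin.castLE (h c.1) c.2⟩

/-- The extension of a filling to a larger shape by a constant letter. -/
def extendFilling {l : ℕ} {lam mu : Fin l → ℕ} (t : Letter N) (T : Cell mu → Letter N) :
    Cell lam → Letter N :=
  fun c => if h : (c.2 : ℕ) < mu c.1 then T ⟨c.1, ⟨c.2, h⟩⟩ else t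

theorem restrictFilling_mem {l : ℕ} {lam mu : Fin (l + 1) → ℕ} (t : Letter N)
    (hle : ∀ i, mu i ≤ lam i) {T : Cell lam → Letter N}
    (hT : T ∈ fillings lam (BlockPred l t.index (t.rank + 1)))
    (hmu : shapeBelow T t.rank = mu) :
    restrictFilling hle T ∈ fillings mu (BlockPred l t.index t.rank) := by
  subst hmu
  rw [mem_fillings] at hT ⊢
  obtain ⟨hT, hP⟩ := hT
  have hinj : ∀ c d : Cell (shapeBelow T t.rank),
      (⟨c.1, Fin.castLE (hle c.1) c.2⟩ : Cell lam) = ⟨d.1, Fin.castLE (hle d.1) d.2⟩ → c = d := by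
    rintro ⟨i, d⟩ ⟨j, e⟩ h
    obtain rfl : i = j := congrArg Sigma.fst h
    simp only [Sigma.mk.injEq, heq_eq_eq, true_and, Fin.castLE_inj] at h
    rw [h]
  refine ⟨⟨fun c d h1 h2 => hT.row_weak _ _ h1 h2, fun c d h1 h2 => hT.col_weak _ _ h1 h2,
    fun c d h1 h2 h3 => hinj _ _ (hT.row_primed _ _ h1 h2 h3),
    fun c d h1 h2 h3 => hinj _ _ (hT.col_unprimed _ _ h1 h2 h3),
    fun c d h1 h2 h3 => hinj _ _ (hT.diag _ _ h1 h2 h3)⟩, fun c => ⟨?_,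
      (hP ⟨c.1, Fin.castLE (hle c.1) c.2⟩).2⟩⟩
  exact (lt_shapeBelow hT t.rank c.1 c.2 _).1 c.2.2

theorem extendFilling_mem {l : ℕ} {lam mu : Fin (l + 1) → ℕ} (hlam : StrictAnti lam)
    (t : Letter N) (hmu : mu ∈ strips t lam) {T : Cell mu → Letter N}
    (hT : T ∈ fillings mu (BlockPred l t.index t.rank)) :
    (extendFilling t T : Cell lam → Letter N) ∈
      fillings lam (BlockPred l t.index (t.rank + 1)) := by
  rw [mem_strips] at hmu
  obtain ⟨hle, hmu, hp, hu⟩ := hmu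
  rw [mem_fillings] at hT ⊢
  obtain ⟨hT, hP⟩ := hT
  have hin : ∀ (c : Cell lam) (h : (c.2 : ℕ) < mu c.1),
      (extendFilling t T : Cell lam → Letter N) c = T ⟨c.1, ⟨c.2, h⟩⟩ := fun c h => dif_pos h
  have hout : ∀ (c : Cell lam), ¬ (c.2 : ℕ) < mu c.1 →
      (extendFilling t T : Cell lam → Letter N) c = t := fun c h => dif_neg h
  have hrk : ∀ c, (T c).rank < t.rank := fun c => (hP c).1
  have hne : ∀ c, T c ≠ t := fun c h => (hrk c).ne (by rw [h])
  -- By strictness only the last row of `mu` can be empty, so only there can `t` be put on the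
  -- diagonal.
  have hpos : ∀ (c : Cell lam), ¬ (c.2 : ℕ) < mu c.1 → (c.2 : ℕ) = 0 → c.1 = Fin.last l := by
    intro c hc h0
    by_contra hl
    have := hmu (Fin.lt_last_iff_ne_last.2 hl)
    omega
  have hcell : ∀ (c d : Cell lam) hc hd,
      (⟨c.1, ⟨c.2, hc⟩⟩ : Cell mu) = ⟨d.1, ⟨d.2, hd⟩⟩ → c = d := by
    rintro ⟨i, d⟩ ⟨j, e⟩ hc hd h
    obtain rfl : i = j := congrArg Sigma.fst h
    simp only [Sigma.mk.injEq, heq_eq_eq, true_and, Fin.mk.injEq] at h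
    rw [Fin.ext h]
  have hext : ∀ (c d : Cell lam), c.1 = d.1 → (c.2 : ℕ) = d.2 → c = d := by
    rintro ⟨i, d⟩ ⟨j, e⟩ h h'
    obtain rfl : i = j := h
    exact congrArg _ (Fin.ext h')
  refine ⟨⟨?_, ?_, ?_, ?_, ?_⟩, ?_⟩
  · intro c d h1 h2
    have h1' : c.1 = d.1 := Fin.ext h1
    simp only [Cell.col, h1, Cell.content] at h2
    by_cases hd : (d.2 : ℕ) < mu d.1
    · have hc : (c.2 : ℕ) < mu c.1 := by
        have : mu c.1 = mu d.1 := congrArg mu h1'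
        omega
      rw [hin c hc, hin d hd]
      refine hT.row_weak _ _ h1 ?_
      have : (c.1 : ℕ) = d.1 := h1
      simp only [Cell.col, Cell.row, Cell.content]
      omega
    · rw [hout d hd]
      by_cases hc : (c.2 : ℕ) < mu c.1
      · rw [hin c hc]
        exact (hrk _).le
      · rw [hout c hc]
  · intro c d h1 h2
    have h1' := h1
    have h2' : c.1 ≤ d.1 := h2
    have h3 : (c.1 : ℕ) ≤ d.1 := h2'
    have h4 := strictAnti_add_le hmu h2'
    simp only [Cell.col, Cell.content, Cell.row] at h1'
    by_cases hd : (d.2 : ℕ) < mu d.1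
    · have hc : (c.2 : ℕ) < mu c.1 := by omega
      rw [hin c hc, hin d hd]
      exact hT.col_weak _ _ h1 h2
    · rw [hout d hd]
      by_cases hc : (c.2 : ℕ) < mu c.1
      · rw [hin c hc]
        exact (hrk _).le
      · rw [hout c hc]
  · intro c d h1 h2 h3
    have h1' : c.1 = d.1 := Fin.ext h1
    by_cases hc : (c.2 : ℕ) < mu c.1 <;> by_cases hd : (d.2 : ℕ) < mu d.1
    · rw [hin c hc, hin d hd] at h2
      rw [hin c hc] at h3
      exact hcell _ _ hc hd (hT.row_primed _ _ h1 h2 h3)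
    · rw [hin c hc, hout d hd] at h2
      exact absurd h2 (hne _)
    · rw [hin d hd, hout c hc] at h2
      exact absurd h2.symm (hne _)
    · rw [hout c hc] at h3
      refine hext _ _ h1' ?_
      have e1 := hp h3 c.1
      have e2 := hp h3 d.1
      have e3 := c.2.2
      have e4 := d.2.2
      have e5 : mu c.1 = mu d.1 := by rw [h1']
      omega
  · have key : ∀ c d : Cell lam, Cell.col c = Cell.col d → c.1 ≤ d.1 →
        (extendFilling t T : Cell lam → Letter N) c = extendFilling t T d →
        ¬ ((extendFilling t T : Cell lam → Letter N) c).IsPrimed → c = d := by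
      intro c d h1 hcd h2 h3
      by_cases hc : (c.2 : ℕ) < mu c.1 <;> by_cases hd : (d.2 : ℕ) < mu d.1
      · rw [hin c hc, hin d hd] at h2
        rw [hin c hc] at h3
        exact hcell _ _ hc hd (hT.col_unprimed _ _ h1 h2 h3)
      · rw [hin c hc, hout d hd] at h2
        exact absurd h2 (hne _)
      · rw [hin d hd, hout c hc] at h2
        exact absurd h2.symm (hne _)
      · rw [hout c hc] at h3
        simp only [Cell.col, Cell.content, Cell.row] at h1
        rcases hcd.eq_or_lt with h | h
        · have : (c.1 : ℕ) = d.1 := by rw [h]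
          exact hext _ _ h (by omega)
        · exfalso
          have hl : (c.1 : ℕ) < d.1 := h
          have hl' : (c.1 : ℕ) + 1 < l + 1 := by have := d.1.2; omega
          -- The row below `c` ends strictly left of the first added cell in the row of `c`, and
          -- lower rows reach no further right.
          have e1 := hu h3 c.1 ⟨c.1 + 1, hl'⟩ (Fin.lt_def.2 (Nat.lt_succ_self _))
          have e2 := strictAnti_add_le hlam (i := ⟨c.1 + 1, hl'⟩) (j := d.1) (Fin.le_def.2 hl)
          have e3 := d.2.2
          simp only at e2
          omega
    intro c d h1 h2 h3
    rcases le_total c.1 d.1 with h | h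
    · exact key c d h1 h h2 h3
    · exact (key d c h1.symm h h2.symm (by rwa [← h2])).symm
  · intro c d h1 h2 h3
    have hidx : ∀ c : Cell lam, (c.2 : ℕ) = 0 → ∀ hc : (c.2 : ℕ) < mu c.1, c.1 ≠ Fin.last l →
        (T ⟨c.1, ⟨c.2, hc⟩⟩).index ≠ t.index := by
      intro c h0 hc hl h
      have := ((hP ⟨c.1, ⟨c.2, hc⟩⟩).2 h0).1 (Fin.lt_last_iff_ne_last.2 hl)
      rw [h] at this
      exact lt_irrefl _ this
    by_cases hc : (c.2 : ℕ) < mu c.1 <;> by_cases hd : (d.2 : ℕ) < mu d.1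
    · rw [hin c hc, hin d hd] at h3
      exact hcell _ _ hc hd (hT.diag _ _ h1 h2 h3)
    · rw [hin c hc, hout d hd] at h3
      have hdl := hpos d hd h2
      by_cases hl : c.1 = Fin.last l
      · exact hext _ _ (hl.trans hdl.symm) (h1.trans h2.symm)
      · exact absurd h3 (hidx c h1 hc hl)
    · rw [hin d hd, hout c hc] at h3
      have hcl := hpos c hc h1
      by_cases hl : d.1 = Fin.last l
      · exact hext _ _ (hcl.trans hl.symm) (h1.trans h2.symm)
      · exact absurd h3.symm (hidx d h2 hd hl)
    · exact hext _ _ ((hpos c hc h1).trans (hpos d hd h2).symm) (h1.trans h2.symm)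
  · intro c
    by_cases hc : (c.2 : ℕ) < mu c.1
    · rw [hin c hc]
      exact ⟨Nat.lt_succ_of_lt (hrk _), (hP ⟨c.1, ⟨c.2, hc⟩⟩).2⟩
    · rw [hout c hc]
      refine ⟨Nat.lt_succ_self _, fun h0 => ?_⟩
      have := hpos c hc h0
      simp [Cell.row, this]

theorem prod_fin_dite {M : Type*} [CommMonoid M] {m n : ℕ} (h : m ≤ n) (G : Fin m → M)
    (W : ℕ → M) :
    ∏ d : Fin n, (if h : (d : ℕ) < m then G ⟨d, h⟩ else W d) =
      (∏ d ∈ Ico m n, W d) * ∏ d, G d := by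
  obtain ⟨k, rfl⟩ := Nat.exists_eq_add_of_le h
  rw [Fin.prod_univ_add, prod_Ico_eq_prod_range, Nat.add_sub_cancel_left, prod_range, mul_comm]
  simp

/-- Removal of the cells which carry the largest letter. -/
theorem fillingSum_succ {K : Type*} [Field K] (a : ℕ → K) (x : Fin N → K) {l : ℕ}
    {lam : Fin (l + 1) → ℕ} (hlam : StrictAnti lam) (t : Letter N) :
    fillingSum a x lam (BlockPred l t.index (t.rank + 1)) =
      ∑ mu ∈ strips t lam, (∏ i, ∏ d ∈ Ico (mu i) (lam i), letterWeight a x d t) *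
        fillingSum a x mu (BlockPred l t.index t.rank) := by
  classical
  rw [fillingSum, ← sum_fiberwise_of_maps_to (t := strips t lam)
    (g := fun T => shapeBelow T t.rank) fun T hT => shapeBelow_mem_strips hlam t hT]
  refine sum_congr rfl fun mu hmu => ?_
  have hle := ((mem_strips t).1 hmu).1
  rw [fillingSum, mul_sum]
  have hinv : ∀ T ∈ {T ∈ fillings lam (BlockPred l t.index (t.rank + 1)) |
      shapeBelow T t.rank = mu}, extendFilling t (restrictFilling hle T) = T := by
    intro T hT
    rw [mem_filter, mem_fillings] at hT
    obtain ⟨⟨hT, hP⟩, hs⟩ := hT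
    funext c
    unfold extendFilling
    split_ifs with h
    · rfl
    · apply Letter.rank_injective
      have h1 := (hP c).1
      have h2 := (lt_shapeBelow hT t.rank c.1 c.2 c.2.2).not.1 (by rwa [hs])
      have h3 : ¬ (T c).rank < t.rank := h2
      omega
  refine sum_bij' (fun T _ => restrictFilling hle T) (fun T _ => extendFilling t T) ?_ ?_ hinv
    ?_ ?_
  · intro T hT
    rw [mem_filter] at hT
    exact restrictFilling_mem t hle hT.1 hT.2
  · intro T hT
    rw [mem_filter]
    have h1 := extendFilling_mem hlam t hmu hT
    refine ⟨h1, ?_⟩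
    rw [mem_fillings] at h1 hT
    refine shapeBelow_eq h1.1 _ hle fun i d h => ?_
    unfold extendFilling
    split_ifs with h'
    · exact ⟨fun _ => (hT.2 _).1, fun _ => h'⟩
    · exact ⟨fun h => absurd h h', fun h => absurd h (lt_irrefl _)⟩
  · intro T hT
    funext c
    exact dif_pos c.2.2
  · intro T hT
    conv_lhs => rw [← hinv T hT]
    rw [Fintype.prod_sigma, Fintype.prod_sigma, ← prod_mul_distrib]
    refine prod_congr rfl fun i _ => ?_
    rw [← prod_fin_dite (hle i)]
    refine prod_congr rfl fun d _ => ?_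
    simp only [extendFilling, Cell.content]
    split_ifs <;> rfl

end Fillings
-- Tableaux as a symmetrized product
section FillingSum

variable {N : ℕ} {K : Type*} [Field K]

theorem IsFilling.comp {l m : ℕ} {lam : Fin l → ℕ} {mu : Fin m → ℕ} {T : Cell lam → Letter N}
    (hT : IsFilling T) (e : Cell mu ≃ Cell lam) (hr : ∀ c, Cell.row (e c) = Cell.row c)
    (hc : ∀ c, Cell.content (e c) = Cell.content c) : IsFilling (T ∘ e) := by
  have hcol : ∀ c, Cell.col (e c) = Cell.col c := fun c => by rw [Cell.col, hr, hc, Cell.col]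
  exact ⟨fun c d h1 h2 => hT.row_weak _ _ (by rwa [hr, hr]) (by rwa [hcol, hcol]),
    fun c d h1 h2 => hT.col_weak _ _ (by rwa [hcol, hcol]) (by rwa [hr, hr]),
    fun c d h1 h2 h3 => e.injective (hT.row_primed _ _ (by rwa [hr, hr]) h2 h3),
    fun c d h1 h2 h3 => e.injective (hT.col_unprimed _ _ (by rwa [hcol, hcol]) h2 h3),
    fun c d h1 h2 h3 => e.injective (hT.diag _ _ (by rwa [hc]) (by rwa [hc]) h3)⟩

theorem fillingSum_equiv (a : ℕ → K) (x : Fin N → K) {l m : ℕ} {lam : Fin l → ℕ}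
    {mu : Fin m → ℕ} (P : ℕ → ℕ → Letter N → Prop) (e : Cell mu ≃ Cell lam)
    (hr : ∀ c, Cell.row (e c) = Cell.row c) (hc : ∀ c, Cell.content (e c) = Cell.content c) :
    fillingSum a x lam P = fillingSum a x mu P := by
  have hr' : ∀ c, Cell.row (e.symm c) = Cell.row c := fun c => by rw [← hr, e.apply_symm_apply]
  have hc' : ∀ c, Cell.content (e.symm c) = Cell.content c := fun c => by
    rw [← hc, e.apply_symm_apply]
  refine sum_bij' (fun T _ => T ∘ e) (fun T _ => T ∘ e.symm) ?_ ?_ ?_ ?_ ?_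
  · intro T hT
    rw [mem_fillings] at hT ⊢
    refine ⟨hT.1.comp e hr hc, fun c => ?_⟩
    have := hT.2 (e c)
    rwa [hr, hc] at this
  · intro T hT
    rw [mem_fillings] at hT ⊢
    refine ⟨hT.1.comp e.symm hr' hc', fun c => ?_⟩
    have := hT.2 (e.symm c)
    rwa [hr', hc'] at this
  · intro T _
    funext c
    simp
  · intro T _
    funext c
    simp
  · intro T _
    rw [← e.prod_comp]
    simp only [hc, Function.comp]

/-- Rows of length zero at the bottom may be removed. -/
theorem fillingSum_of_zero_rows (a : ℕ → K) (x : Fin N → K) {l m : ℕ} (hlm : l ≤ m)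
    {lam : Fin m → ℕ} {mu : Fin l → ℕ} (h1 : ∀ i, lam (Fin.castLE hlm i) = mu i)
    (h2 : ∀ i : Fin m, l ≤ i → lam i = 0) (P : ℕ → ℕ → Letter N → Prop) :
    fillingSum a x lam P = fillingSum a x mu P := by
  refine fillingSum_equiv a x P (Equiv.ofBijective
    (fun c : Cell mu => (⟨Fin.castLE hlm c.1, Fin.cast (h1 c.1).symm c.2⟩ : Cell lam)) ⟨?_, ?_⟩)
    (fun _ => rfl) (fun _ => rfl)
  · rintro ⟨i, d⟩ ⟨j, e⟩ h
    obtain rfl : i = j := Fin.castLE_injective hlm (congrArg Sigma.fst h)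
    simp only [Sigma.mk.injEq, heq_eq_eq, true_and, Fin.cast_inj] at h
    rw [h]
  · rintro ⟨i, d⟩
    have hi : (i : ℕ) < l := by
      by_contra hi
      have := h2 i (by omega)
      have := d.2
      omega
    exact ⟨⟨⟨i, hi⟩, ⟨d, by rw [← h1]; exact d.2⟩⟩, rfl⟩

theorem fillingSum_congr (a : ℕ → K) (x : Fin N → K) {l : ℕ} {lam : Fin l → ℕ}
    {P P' : ℕ → ℕ → Letter N → Prop}
    (h : ∀ T : Cell lam → Letter N, IsFilling T →
      ((∀ c, P (Cell.row c) (Cell.content c) (T c)) ↔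
        ∀ c, P' (Cell.row c) (Cell.content c) (T c))) :
    fillingSum a x lam P = fillingSum a x lam P' := by
  refine sum_congr ?_ fun _ _ => rfl
  ext T
  rw [mem_fillings, mem_fillings]
  exact and_congr_right fun hT => h T hT

theorem fillingSum_empty (a : ℕ → K) (x : Fin N → K) (lam : Fin 0 → ℕ)
    (P : ℕ → ℕ → Letter N → Prop) : fillingSum a x lam P = 1 := by
  have : IsEmpty (Cell lam) := ⟨fun c => c.1.elim0⟩
  have h : fillings lam P = univ := by
    ext T
    simp only [mem_fillings, mem_univ, iff_true]
    exact ⟨⟨fun c => isEmptyElim c, fun c => isEmptyElim c, fun c => isEmptyElim c,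
      fun c => isEmptyElim c, fun c => isEmptyElim c⟩, fun c => isEmptyElim c⟩
  rw [fillingSum, h]
  simp

/-- Before the letters of index `k` are available, row `l` has no admissible diagonal letter and
must be empty. -/
theorem fillingSum_block_zero (a : ℕ → K) (x : Fin N → K) {l : ℕ} (lam : Fin (l + 1) → ℕ)
    (k : ℕ) :
    fillingSum a x lam (BlockPred l k (4 * k)) =
      if lam (Fin.last l) = 0 then
        fillingSum a x (fun i : Fin l => lam i.castSucc) (fun _ _ t => t.rank < 4 * k)
      else 0 := by
  split_ifs with h
  · rw [← fillingSum_of_zero_rows a x (Nat.le_succ l) (lam := lam)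
      (mu := fun i : Fin l => lam i.castSucc) (fun i => rfl) (fun i hi => by
      have : i = Fin.last l := Fin.ext (by have := i.2; simp only [Fin.val_last]; omega)
      rwa [this])]
    refine fillingSum_congr a x fun T _ => ⟨fun hP c => (hP c).1, fun hP c => ⟨hP c, fun h0 => ?_⟩⟩
    refine iff_of_true ?_ ((Letter.index_lt_iff _ _).2 (hP c))
    by_contra hl
    have h1 : c.1 = Fin.last l := Fin.ext (by
      have := c.1.2
      simp only [Cell.row] at hl
      simp only [Fin.val_last]; omega)
    have := c.2.2
    have h2 : lam c.1 = 0 := by rw [h1, h]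
    omega
  · refine sum_eq_zero fun T hT => ?_
    exfalso
    have := (mem_fillings.1 hT).2 ⟨Fin.last l, ⟨0, Nat.pos_of_ne_zero h⟩⟩
    have h1 := (Letter.index_lt_iff _ _).2 this.1
    have h2 := (this.2 rfl).2 h1
    simp [Cell.row] at h2

/-- Walk right along row i to column j, then down to the diagonal. -/
theorem IsFilling.diag_mono {l : ℕ} {lam : Fin l → ℕ} (hlam : StrictAnti lam)
    {T : Cell lam → Letter N} (hT : IsFilling T) {i j : Fin l} (hij : i ≤ j) (hi : 0 < lam i)
    (hj : 0 < lam j) : (T ⟨i, ⟨0, hi⟩⟩).rank ≤ (T ⟨j, ⟨0, hj⟩⟩).rank := by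
  have h1 := strictAnti_add_le hlam hij
  have h2 : (i : ℕ) ≤ j := hij
  have h3 : (j : ℕ) - i < lam i := by omega
  refine (hT.row_weak ⟨i, ⟨0, hi⟩⟩ ⟨i, ⟨j - i, h3⟩⟩ rfl ?_).trans (hT.col_weak _ ⟨j, ⟨0, hj⟩⟩ ?_ h2) <;>
    simp only [Cell.col, Cell.row, Cell.content] <;> omega

/-- The diagonal increases and carries the index `k` at most once, so only the last row can start
with it. If it does not, an empty row is adjoined, so that in both cases the last row is the one
which the block may create. -/
theorem fillingSum_split (a : ℕ → K) (x : Fin N → K) {l : ℕ} {lam : Fin (l + 1) → ℕ}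
    (hlam : StrictAnti lam) (hpos : ∀ i, 0 < lam i) (k : ℕ) :
    fillingSum a x lam (fun _ _ t => t.rank < 4 * (k + 1)) =
      fillingSum a x (Fin.snoc lam 0 : Fin (l + 2) → ℕ) (BlockPred (l + 1) k (4 * (k + 1))) +
        fillingSum a x lam (BlockPred l k (4 * (k + 1))) := by
  classical
  rw [fillingSum_of_zero_rows a x (Nat.le_succ (l + 1)) (lam := Fin.snoc lam 0) (mu := lam)
    (fun i => Fin.snoc_castSucc (α := fun _ => ℕ) ..) (fun i hi => by
      have : i = Fin.last (l + 1) := Fin.ext (by have := i.2; simp only [Fin.val_last]; omega)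
      rw [this, Fin.snoc_last])]
  rw [fillingSum, ← sum_filter_add_sum_filter_not _
    (fun T => ((T ⟨Fin.last l, ⟨0, hpos _⟩⟩).index : ℕ) < k)]
  have hidx : ∀ s t : Letter N, s.rank ≤ t.rank → (s.index : ℕ) ≤ t.index := by
    intro s t h
    cases s <;> cases t <;> simp only [Letter.rank, Letter.index] at h ⊢ <;> omega
  have hcell : ∀ c : Cell lam, Cell.content c = 0 → c = ⟨c.1, ⟨0, hpos _⟩⟩ := by
    rintro ⟨i, d⟩ h
    exact congrArg _ (Fin.ext h)
  congr 1 <;> refine sum_congr ?_ fun _ _ => rfl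
  · ext T
    rw [mem_filter, mem_fillings, mem_fillings]
    constructor
    · rintro ⟨⟨hT, hr⟩, hk⟩
      refine ⟨hT, fun c => ⟨hr c, fun h0 => iff_of_true c.1.2 ?_⟩⟩
      rw [hcell c h0]
      exact lt_of_le_of_lt (hidx _ _ (hT.diag_mono hlam (Fin.le_last c.1) _ _)) hk
    · rintro ⟨hT, hP⟩
      refine ⟨⟨hT, fun c => (hP c).1⟩, ((hP ⟨Fin.last l, ⟨0, hpos _⟩⟩).2 rfl).1 ?_⟩
      exact (Fin.last l).2
  · ext T
    rw [mem_filter, mem_fillings, mem_fillings]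
    constructor
    · rintro ⟨⟨hT, hr⟩, hk⟩
      refine ⟨hT, fun c => ⟨hr c, fun h0 => ?_⟩⟩
      by_cases hl : c.1 = Fin.last l
      · refine iff_of_false (by simp [Cell.row, hl]) ?_
        obtain ⟨i, d⟩ := c
        obtain rfl : i = Fin.last l := hl
        rwa [hcell _ h0]
      · refine iff_of_true (Fin.lt_last_iff_ne_last.2 hl) ?_
        have h1 := hidx _ _ (hT.diag_mono hlam (Fin.le_last c.1) (hpos _) (hpos _))
        have h2 : (T c).index ≠ (T ⟨Fin.last l, ⟨0, hpos _⟩⟩).index := fun h =>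
          hl (congrArg Sigma.fst (hT.diag c _ h0 rfl h))
        have h3 := (Letter.index_lt_iff _ _).2 (hr ⟨Fin.last l, ⟨0, hpos _⟩⟩)
        rw [← hcell c h0] at h1
        have h4 : ((T c).index : ℕ) ≠ (T ⟨Fin.last l, ⟨0, hpos _⟩⟩).index := fun h =>
          h2 (Fin.ext h)
        omega
    · rintro ⟨hT, hP⟩
      refine ⟨⟨hT, fun c => (hP c).1⟩, fun h => ?_⟩
      have := ((hP ⟨Fin.last l, ⟨0, hpos _⟩⟩).2 rfl).2 h
      simp [Cell.row] at this

/-- The one-particle transfer operator of a letter. -/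
def letterOp (a : ℕ → K) (x : Fin N → K) : Letter N → (ℕ → K) → ℕ → K
  | .primed k => vertOp a (x k)
  | .plain k => horOp a (x k)
  | .barPrimed k => vertOp a (x k)⁻¹
  | .bar k => horOp a (x k)⁻¹

theorem seqDet_letterOp (a : ℕ → K) (x : Fin N → K) (t : Letter N) {l : ℕ} (v : Fin l → ℕ → K)
    (lam : Fin l → ℕ) (hlam : StrictAnti lam) :
    seqDet (fun j => letterOp a x t (v j)) lam =
      ∑ mu ∈ strips t lam, (∏ i, ∏ d ∈ Ico (mu i) (lam i), letterWeight a x d t) *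
        seqDet v mu := by
  cases t
  · exact seqDet_vertOp a _ v lam hlam
  · exact seqDet_horOp a _ v lam hlam
  · exact seqDet_vertOp a _ v lam hlam
  · exact seqDet_horOp a _ v lam hlam

theorem fillingSum_letter (a : ℕ → K) (x : Fin N → K) (t : Letter N) {l : ℕ} {S : Type*}
    [Fintype S] (c : S → K) (v : S → Fin (l + 1) → ℕ → K)
    (h : ∀ mu : Fin (l + 1) → ℕ, StrictAnti mu →
      fillingSum a x mu (BlockPred l t.index t.rank) = ∑ s, c s * seqDet (v s) mu)
    (lam : Fin (l + 1) → ℕ) (hlam : StrictAnti lam) :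
    fillingSum a x lam (BlockPred l t.index (t.rank + 1)) =
      ∑ s, c s * seqDet (fun j => letterOp a x t (v s j)) lam := by
  simp only [fillingSum_succ a x hlam t, seqDet_letterOp a x t _ lam hlam, mul_sum]
  rw [sum_comm]
  refine sum_congr rfl fun mu hmu => ?_
  rw [h mu ((mem_strips t).1 hmu).2.1, mul_sum]
  exact sum_congr rfl fun s _ => by ring

theorem fillingSum_block (a : ℕ → K) (x : Fin N → K) (k : Fin N) {l : ℕ} {S : Type*}
    [Fintype S] (c : S → K) (v : S → Fin (l + 1) → ℕ → K)
    (h : ∀ mu : Fin (l + 1) → ℕ, StrictAnti mu →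
      fillingSum a x mu (BlockPred l k (4 * k)) = ∑ s, c s * seqDet (v s) mu)
    (lam : Fin (l + 1) → ℕ) (hlam : StrictAnti lam) :
    fillingSum a x lam (BlockPred l k (4 * (k + 1))) =
      ∑ s, c s * seqDet (fun j => blockOp a (x k) (v s j)) lam :=
  -- The four ranks are consecutive, so each conclusion is definitionally the hypothesis for the
  -- next letter.
  fillingSum_letter a x (.bar k) c _ (fillingSum_letter a x (.barPrimed k) c _
    (fillingSum_letter a x (.plain k) c _ (fillingSum_letter a x (.primed k) c v h))) lam hlam

/-- Only the last entry of a strict sequence can be 0, so the extra column detects an empty last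
row, as needed for `fillingSum_block_zero`. -/
theorem seqDet_snoc_unitSeq {l : ℕ} (v : Fin l → ℕ → K) (mu : Fin (l + 1) → ℕ)
    (hmu : StrictAnti mu) :
    seqDet (Fin.snoc v unitSeq) mu =
      if mu (Fin.last l) = 0 then seqDet v (fun i => mu i.castSucc) else 0 := by
  rw [seqDet, Matrix.det_succ_column _ (Fin.last l), Fin.sum_univ_castSucc, sum_eq_zero, zero_add]
  · simp only [Matrix.of_apply, Fin.snoc_last, unitSeq, ← two_mul, Fin.val_last]
    split_ifs
    · rw [pow_mul, neg_one_sq, one_pow, one_mul, one_mul, seqDet]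
      congr 1
      ext i j
      simp
    · ring
  · intro i _
    have := hmu (Fin.castSucc_lt_last i)
    simp [unitSeq, (Nat.zero_le _).trans_lt this |>.ne']

theorem seqDet_snoc_zero {l : ℕ} (v : Fin l → ℕ → K) (w : ℕ → K) (lam : Fin l → ℕ)
    (hv : ∀ j, v j 0 = 0) (hw : w 0 = 1) :
    seqDet (Fin.snoc v w) (Fin.snoc lam 0 : Fin (l + 1) → ℕ) = seqDet v lam := by
  rw [seqDet, Matrix.det_succ_row _ (Fin.last l), Fin.sum_univ_castSucc, sum_eq_zero, zero_add]
  · simp only [Matrix.of_apply, Fin.snoc_last, ← two_mul, Fin.val_last, hw]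
    rw [pow_mul, neg_one_sq, one_pow, one_mul, one_mul, seqDet]
    congr 1
    ext i j
    simp
  · intro i _
    simp [hv]

theorem altSum_empty {ι : Type*} [Fintype ι] [DecidableEq ι] (z : ι → K) (f : ι → ℕ → K)
    (A : Finset ι) (lam : Fin 0 → ℕ) : altSum z f A lam = 1 := by
  rw [altSum, Fintype.sum_unique, coef, if_pos ⟨Function.injective_of_subsingleton _,
    fun i => i.elim0⟩]
  simp

/-- Genericity of the variables. -/
structure Generic {ι : Type*} (x : ι → K) : Prop where
  ne_zero : ∀ i, x i ≠ 0
  sq_ne_one : ∀ i, x i ^ 2 ≠ 1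
  ne : ∀ i j, i ≠ j → x i ≠ x j
  mul_ne_one : ∀ i j, i ≠ j → x i * x j ≠ 1

theorem Generic.injective {ι : Type*} {x : ι → K} (h : Generic x) :
    Function.Injective fun i => x i + (x i)⁻¹ := by
  intro i j hij
  by_contra hne
  have h1 := h.ne_zero i
  have h2 := h.ne_zero j
  have h3 : (x i - x j) * (x i * x j - 1) = 0 := by
    have hij' : x i + (x i)⁻¹ = x j + (x j)⁻¹ := hij
    field_simp at hij'
    linear_combination hij'
  rcases mul_eq_zero.1 h3 with h4 | h4
  · exact h.ne i j hne (sub_eq_zero.1 h4)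
  · exact h.mul_ne_one i j hne (sub_eq_zero.1 h4)

theorem fillingSum_eq_altSum [CharZero K] (a : ℕ → K) (ha : a 0 = 0) (x : Fin N → K)
    (hx : Generic x) (k : ℕ) (hk : k ≤ N) {l : ℕ} (lam : Fin l → ℕ) (hlam : StrictAnti lam)
    (hpos : ∀ i, 0 < lam i) :
    fillingSum a x lam (fun _ _ t => t.rank < 4 * k) =
      altSum (fun i => x i + (x i)⁻¹) (fun i => oneRow a (x i)) {i | (i : ℕ) < k} lam := by
  induction k generalizing l with
  | zero =>
    rcases l with _ | l
    · rw [fillingSum_empty, altSum_empty]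
    · rw [fillingSum, altSum, sum_eq_zero, sum_eq_zero]
      · exact fun s _ => mul_eq_zero_of_left (if_neg fun h => by simpa using h.2 0) _
      · intro T hT
        have := (mem_fillings.1 hT).2 ⟨0, ⟨0, hpos 0⟩⟩
        omega
  | succ k ih =>
    rcases l with _ | l
    · rw [fillingSum_empty, altSum_empty]
    set z : Fin N → K := fun i => x i + (x i)⁻¹ with hz
    set f : Fin N → ℕ → K := fun i => oneRow a (x i) with hf
    set A : Finset (Fin N) := {i | (i : ℕ) < k} with hA
    set κ : Fin N := ⟨k, hk⟩ with hκ
    have hκA : κ ∉ A := by simp [hA, hκ]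
    have hins : ({i | (i : ℕ) < k + 1} : Finset (Fin N)) = insert κ A := by
      ext i
      simp only [hA, hκ, mem_filter, mem_univ, true_and, mem_insert, Fin.ext_iff]
      omega
    have hfac : ∀ m : ℕ, (m.factorial : K) ≠ 0 := fun m => Nat.cast_ne_zero.2 m.factorial_ne_zero
    -- The induction hypothesis for the first `m` rows, in determinant form, with the still empty
    -- last row recorded by `unitSeq`.
    have hbase : ∀ (m : ℕ) (mu : Fin (m + 1) → ℕ), StrictAnti mu →
        fillingSum a x mu (BlockPred m κ (4 * κ)) = ∑ s : Fin m → Fin N,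
          (coef z A s / m.factorial) * seqDet (Fin.snoc (fun j => f (s j)) unitSeq) mu := by
      intro m mu hmu
      rw [fillingSum_block_zero]
      simp only [seqDet_snoc_unitSeq _ mu hmu]
      split_ifs with h0
      · rw [ih (Nat.le_of_succ_le hk) _ (fun i j hij => hmu (Fin.castSucc_lt_castSucc_iff.2 hij))
          fun i => lt_of_le_of_lt (Nat.zero_le _) (hmu (Fin.castSucc_lt_last i)),
          ← mul_right_inj' (hfac m), factorial_mul_altSum, mul_sum]
        refine sum_congr rfl fun s _ => ?_
        have := hfac m
        field_simp
      · simp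
    have hstep := fun m => fillingSum_block a x κ (l := m) _ _ (hbase m)
    have h0 : ∀ (v : ℕ → K), blockOp a (x κ) v 0 = v 0 := fun v => by
      rw [blockOp, stepOp_zero, stepOp_zero]
    have hunit := blockOp_unitSeq a ha (x κ) (hx.ne_zero κ) (hx.sq_ne_one κ)
    rw [fillingSum_split a x hlam hpos, hins]
    have e1 := hstep (l + 1) (Fin.snoc lam 0) (by
      intro i j
      refine Fin.lastCases ?_ (fun j => ?_) j
      · refine Fin.lastCases (fun h => absurd h (lt_irrefl _)) (fun i _ => ?_) i
        simpa using hpos i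
      · refine Fin.lastCases (fun h => absurd h (Fin.castSucc_lt_last j).not_gt)
          (fun i h => ?_) i
        simpa using hlam (Fin.castSucc_lt_castSucc_iff.1 h))
    have e2 := hstep l lam hlam
    simp only [comp_snoc (blockOp a (x κ)), hunit] at e1 e2
    -- All parts are positive, so the `unitSeq` part of the last column vanishes: a row is born.
    have e3 : ∀ s : Fin l → Fin N,
        seqDet (Fin.snoc (fun j => blockOp a (x κ) (f (s j)))
          fun r => unitSeq r + oneRow a (x κ) r) lam =
        seqDet (Fin.snoc (fun j => blockOp a (x κ) (f (s j))) (f κ)) lam := by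
      intro s
      rw [seqDet, seqDet]
      congr 1
      ext i j
      refine Fin.lastCases ?_ (fun j => ?_) j
      · simp [unitSeq, (hpos i).ne', hf]
      · simp
    -- The adjoined part 0 kills every entry of the bottom row but the last, which is 1: no row is
    -- born.
    have e4 : ∀ s : Fin (l + 1) → Fin N,
        seqDet (Fin.snoc (fun j => blockOp a (x κ) (f (s j)))
          fun r => unitSeq r + oneRow a (x κ) r) (Fin.snoc lam 0) =
        seqDet (fun j => blockOp a (x κ) (f (s j))) lam := fun s =>
      seqDet_snoc_zero _ _ _ (fun j => by rw [h0]; exact oneRow_zero _ _)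
        (by simp [unitSeq, oneRow_zero])
    simp only [e3] at e2
    simp only [e4] at e1
    have hmain := altSum_insert z f (fun j => blockOp a (x κ) (f j)) A κ hκA
      hx.injective.injOn (fun j hj r => by
        have hne : j ≠ κ := fun h => hκA (h ▸ hj)
        exact blockOp_oneRow a (x j) (x κ) (hx.ne_zero j) (hx.ne_zero κ) (hx.sq_ne_one j)
          (hx.sq_ne_one κ) (hx.ne j κ hne) (hx.mul_ne_one j κ hne) r) lam
    rw [factorial_mul_altSum z (fun j => blockOp a (x κ) (f j))] at hmain
    rw [← mul_right_inj' (hfac (l + 1)), hmain]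
    change _ * (fillingSum a x _ (BlockPred (l + 1) κ (4 * (κ + 1))) +
      fillingSum a x lam (BlockPred l κ (4 * (κ + 1)))) = _
    rw [e1, e2, mul_add, mul_sum, mul_sum, mul_sum]
    congr 1
    · refine sum_congr rfl fun s _ => ?_
      have := hfac (l + 1)
      field_simp
    · refine sum_congr rfl fun s _ => ?_
      have := hfac l
      rw [Nat.factorial_succ]
      push_cast
      field_simp

end FillingSum
/-! ### Hall–Littlewood sums -/

section HallLittlewood

variable {L : Type*} [Field L]

theorem Generic.comp {ι κ : Type*} {x : ι → L} (h : Generic x) {e : κ → ι}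
    (he : Function.Injective e) : Generic fun k => x (e k) :=
  ⟨fun _ => h.ne_zero _, fun _ => h.sq_ne_one _, fun _ _ hij => h.ne _ _ (he.ne hij),
    fun _ _ hij => h.mul_ne_one _ _ (he.ne hij)⟩

theorem Generic.zpow_injective {ι : Type*} {x : ι → L} (h : Generic x) :
    Function.Injective fun p : ι × ℤˣ => x p.1 ^ ((p.2 : ℤˣ) : ℤ) := by
  rintro ⟨i, ε⟩ ⟨j, η⟩ hp
  have hi := h.ne_zero i
  have hj := h.ne_zero j
  simp only at hp
  by_cases hij : i = j
  · subst hij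
    have h2 := h.sq_ne_one i
    rcases Int.units_eq_one_or ε with rfl | rfl <;> rcases Int.units_eq_one_or η with rfl | rfl
    · rfl
    · simp only [Units.val_one, zpow_one, Units.val_neg, zpow_neg] at hp
      refine absurd ?_ h2
      rw [sq]; nth_rw 1 [hp]; exact inv_mul_cancel₀ hi
    · simp only [Units.val_one, zpow_one, Units.val_neg, zpow_neg] at hp
      refine absurd ?_ h2
      rw [sq]; nth_rw 1 [← hp]; exact inv_mul_cancel₀ hi
    · rfl
  · have h1 := h.ne i j hij
    have h2 := h.mul_ne_one i j hij
    exfalso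
    rcases Int.units_eq_one_or ε with rfl | rfl <;> rcases Int.units_eq_one_or η with rfl | rfl <;>
      simp only [Units.val_one, zpow_one, Units.val_neg, zpow_neg] at hp
    · exact h1 hp
    · exact h2 (by rw [hp]; exact inv_mul_cancel₀ hj)
    · exact h2 (by rw [← hp]; exact mul_inv_cancel₀ hi)
    · exact h1 (inv_injective hp)

/-- The sum over the Weyl group in the definition of the Hall–Littlewood function. -/
def hlSum {n : ℕ} (lam : Fin n → ℕ) (a : ℕ → L) (t : L) (x : Fin n → L) : L :=
  ∑ w : SignedPerm n, hlSummand lam a t (w.actVar x)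

/-- The factor of `hlSummand` which involves the first variable. -/
def headFactor {n : ℕ} (r : ℕ) (a : ℕ → L) (t y : L) (u : Fin n → L) : L :=
  facMonomial a y r * ((1 - t * y⁻¹ ^ 2) / (1 - y⁻¹ ^ 2)) *
    ∏ j, ((1 - t * y⁻¹ * u j) / (1 - y⁻¹ * u j) *
      ((1 - t * y⁻¹ * (u j)⁻¹) / (1 - y⁻¹ * (u j)⁻¹)))

theorem hlSummand_succ {n : ℕ} (lam : Fin (n + 1) → ℕ) (a : ℕ → L) (t : L)
    (u : Fin (n + 1) → L) :
    hlSummand lam a t u = headFactor (lam 0) a t (u 0) (fun j => u j.succ) *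
      hlSummand (fun j => lam j.succ) a t fun j => u j.succ := by
  rw [hlSummand, hlSummand, headFactor, Fin.prod_univ_succ, Fin.prod_univ_succ (n := n),
    Fin.prod_univ_succ (n := n)]
  simp only [Fin.prod_Ioi_zero, Fin.prod_Ioi_succ]
  ring

/-- The remaining variables enter through a symmetric product in which each one is paired with its
inverse. -/
theorem headFactor_act {n : ℕ} (r : ℕ) (a : ℕ → L) (t y : L) (u : Fin n → L)
    (w : SignedPerm n) :
    headFactor r a t y (w.actVar u) = headFactor r a t y u := by
  rw [headFactor, headFactor]
  congr 1
  rw [← Equiv.prod_comp w.1 fun j => ((1 - t * y⁻¹ * u j) / (1 - y⁻¹ * u j) *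
      ((1 - t * y⁻¹ * (u j)⁻¹) / (1 - y⁻¹ * (u j)⁻¹)))]
  refine prod_congr rfl fun j _ => ?_
  rw [SignedPerm.actVar]
  rcases Int.units_eq_one_or (w.2 (w.1 j)) with h | h <;> rw [h]
  · simp
  · simp only [Units.val_neg, Units.val_one, zpow_neg, zpow_one, inv_inv]
    rw [mul_comm]

/-- A signed permutation is determined by the image of the first variable and a signed permutation
of the remaining ones. -/
def consSigned {n : ℕ} (p : (Fin (n + 1) × ℤˣ) × SignedPerm n) : SignedPerm (n + 1) :=
  ((Equiv.Perm.decomposeFin.symm (0, p.2.1)).trans p.1.1.cycleRange.symm,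
    Fin.insertNth p.1.1 p.1.2 p.2.2)

theorem consSigned_fst_zero {n : ℕ} (p : (Fin (n + 1) × ℤˣ) × SignedPerm n) :
    (consSigned p).1 0 = p.1.1 := by
  simp [consSigned]

theorem consSigned_fst_succ {n : ℕ} (p : (Fin (n + 1) × ℤˣ) × SignedPerm n) (j : Fin n) :
    (consSigned p).1 j.succ = p.1.1.succAbove (p.2.1 j) := by
  simp [consSigned]

theorem consSigned_bijective {n : ℕ} : Function.Bijective (consSigned (n := n)) := by
  rw [Fintype.bijective_iff_injective_and_card]
  constructor
  · rintro ⟨⟨i, ε⟩, ⟨τ, δ⟩⟩ ⟨⟨i', ε'⟩, ⟨τ', δ'⟩⟩ h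
    have h0 := consSigned_fst_zero ⟨⟨i, ε⟩, ⟨τ, δ⟩⟩
    rw [h, consSigned_fst_zero] at h0
    obtain rfl : i' = i := h0
    have h1 : τ = τ' := by
      ext1 j
      have h1 := consSigned_fst_succ ⟨⟨i', ε⟩, ⟨τ, δ⟩⟩ j
      rw [h, consSigned_fst_succ] at h1
      exact (Fin.succAbove_right_injective h1).symm
    have h2 : (Fin.insertNth i' ε δ : Fin (n + 1) → ℤˣ) = Fin.insertNth i' ε' δ' :=
      congrArg Prod.snd h
    have h3 := congrFun h2 i'
    have h4 : δ = δ' := by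
      funext j
      simpa using congrFun h2 (i'.succAbove j)
    simp only [Fin.insertNth_apply_same] at h3
    rw [h1, h3, h4]
  · simp only [Fintype.card_prod, Fintype.card_perm, Fintype.card_fin, Fintype.card_pi,
      prod_const, card_univ, Nat.factorial_succ, pow_succ]
    ring

theorem hlSum_succ {n : ℕ} (lam : Fin (n + 1) → ℕ) (a : ℕ → L) (t : L) (x : Fin (n + 1) → L) :
    hlSum lam a t x = ∑ i, ∑ ε : ℤˣ,
      headFactor (lam 0) a t (x i ^ ((ε : ℤˣ) : ℤ)) (fun j => x (i.succAbove j)) *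
        hlSum (fun j => lam j.succ) a t fun j => x (i.succAbove j) := by
  rw [hlSum, ← consSigned_bijective.sum_comp, Fintype.sum_prod_type, Fintype.sum_prod_type]
  refine sum_congr rfl fun i _ => sum_congr rfl fun ε _ => ?_
  rw [hlSum, mul_sum]
  refine sum_congr rfl fun w _ => ?_
  have h0 : (consSigned ((i, ε), w)).actVar x 0 = x i ^ ((ε : ℤˣ) : ℤ) := by
    rw [SignedPerm.actVar, consSigned_fst_zero]
    simp [consSigned]
  have h1 : (fun j : Fin n => (consSigned ((i, ε), w)).actVar x j.succ) =
      w.actVar fun j => x (i.succAbove j) := by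
    funext j
    rw [SignedPerm.actVar, consSigned_fst_succ, SignedPerm.actVar]
    simp [consSigned]
  rw [hlSummand_succ, h0, h1, headFactor_act]

/-- The Poincaré polynomial of the Weyl group of type `Cₘ`. -/
def poincare (m : ℕ) (t : L) : L := ∏ i ∈ Icc 1 m, (1 - t ^ (2 * i)) / (1 - t)

/-- The factor in y⁻² is the one belonging to the point y⁻¹, so all the points x_j^{±1} other than y
occur uniformly. -/
theorem headFactor_zero {n : ℕ} (a : ℕ → L) (t : L) (x : Fin (n + 1) → L) (hx : Generic x)
    (i : Fin (n + 1)) (ε : ℤˣ) :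
    headFactor 0 a t (x i ^ ((ε : ℤˣ) : ℤ)) (fun j => x (i.succAbove j)) =
      ∏ q ∈ univ.erase (i, ε), (x i ^ ((ε : ℤˣ) : ℤ) - t * x q.1 ^ ((q.2 : ℤˣ) : ℤ)) /
        (x i ^ ((ε : ℤˣ) : ℤ) - x q.1 ^ ((q.2 : ℤˣ) : ℤ)) := by
  set y := x i ^ ((ε : ℤˣ) : ℤ) with hy
  have hy0 : y ≠ 0 := zpow_ne_zero _ (hx.ne_zero i)
  have hpt : ∀ u : L, (1 - t * y⁻¹ * u) / (1 - y⁻¹ * u) = (y - t * u) / (y - u) := by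
    intro u
    rw [← mul_div_mul_left (1 - t * y⁻¹ * u) _ hy0]
    congr 1 <;> field_simp
  have hpt2 : (1 - t * y⁻¹ ^ 2) / (1 - y⁻¹ ^ 2) = (y - t * y⁻¹) / (y - y⁻¹) := by
    rw [← hpt, sq, mul_assoc]
  have hunits : ∀ g : ℤˣ → L, ∏ η, g η = g 1 * g (-1) := by
    intro g
    rw [UnitsInt.univ, prod_pair (by decide)]
  have herase : ∀ g : Fin (n + 1) × ℤˣ → L, ∏ q ∈ univ.erase (i, ε), g q =
      g (i, -ε) * ∏ j, (g (i.succAbove j, 1) * g (i.succAbove j, -1)) := by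
    intro g
    have : ∏ q ∈ univ.erase (i, ε), g q = ∏ q, if q = (i, ε) then 1 else g q := by
      rw [← mul_prod_erase univ _ (mem_univ (i, ε)), if_pos rfl, one_mul]
      exact prod_congr rfl fun q hq => (if_neg (ne_of_mem_erase hq)).symm
    rw [this, Fintype.prod_prod_type, Fin.prod_univ_succAbove _ i]
    congr 1
    · rw [hunits]
      rcases Int.units_eq_one_or ε with rfl | rfl <;> simp
    · refine prod_congr rfl fun j _ => ?_
      rw [hunits]
      simp [Fin.succAbove_ne]
  rw [herase, headFactor, hpt2]
  simp only [hpt, facMonomial, range_zero, prod_empty, one_mul]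
  congr 1
  · have : x i ^ (((-ε : ℤˣ) : ℤˣ) : ℤ) = y⁻¹ := by
      rw [hy, Units.val_neg, zpow_neg]
    simp only [this]
  · refine prod_congr rfl fun j _ => ?_
    simp

/-- Partial fractions over the 2(n + 1) points x_i^{±1}, evaluated at 0: every factor on the left is
t and every residue is weighted by -(1 - t), so the sum of head factors is (1 - t^{2(n+1)})/(1 - t).
-/
theorem hlSum_zero {n : ℕ} (a : ℕ → L) (t : L) (ht : t ≠ 1) (x : Fin n → L) (hx : Generic x) :
    hlSum (fun _ => 0) a t x = poincare n t := by
  induction n with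
  | zero =>
    rw [hlSum, Fintype.sum_prod_type, Fintype.sum_unique, Fintype.sum_unique]
    simp [hlSummand, poincare]
  | succ n ih =>
    have ht' : 1 - t ≠ 0 := sub_ne_zero.2 ht.symm
    rw [hlSum_succ]
    simp only [fun i : Fin (n + 1) => ih (fun j => x (i.succAbove j))
      (hx.comp Fin.succAbove_right_injective), headFactor_zero a t x hx]
    have hne : ∀ p : Fin (n + 1) × ℤˣ, x p.1 ^ ((p.2 : ℤˣ) : ℤ) ≠ 0 :=
      fun p => zpow_ne_zero _ (hx.ne_zero _)
    have h := prod_sub_mul_div_sub univ (fun p : Fin (n + 1) × ℤˣ => x p.1 ^ ((p.2 : ℤˣ) : ℤ))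
      hx.zpow_injective.injOn t 0 (fun p _ => (hne p).symm)
    have h1 : ∀ p : Fin (n + 1) × ℤˣ, (0 - t * x p.1 ^ ((p.2 : ℤˣ) : ℤ)) /
        (0 - x p.1 ^ ((p.2 : ℤˣ) : ℤ)) = t := by
      intro p
      have := hne p
      rw [zero_sub, zero_sub, neg_div_neg_eq, mul_div_assoc, div_self this, mul_one]
    have h2 : ∀ p : Fin (n + 1) × ℤˣ, (1 - t) * x p.1 ^ ((p.2 : ℤˣ) : ℤ) /
        (0 - x p.1 ^ ((p.2 : ℤˣ) : ℤ)) = -(1 - t) := by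
      intro p
      have := hne p
      rw [zero_sub, div_neg, mul_div_assoc, div_self this, mul_one]
    simp only [h1, h2, prod_const, card_univ, Fintype.card_prod, Fintype.card_fin,
      Fintype.card_units_int, ← mul_sum] at h
    rw [Fintype.sum_prod_type] at h
    simp only [← sum_mul]
    have hp : poincare (n + 1) t = poincare n t * ((1 - t ^ (2 * (n + 1))) / (1 - t)) :=
      prod_Icc_succ_top (by omega) _
    rw [hp, mul_comm]
    congr 1
    rw [eq_div_iff ht']
    rw [mul_comm (n + 1)] at h
    linear_combination h

end HallLittlewood

/-! ### Specialization at t = -1 -/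

section Specialization

variable {K : Type*} [Field K]

/-- The rational function `r` of `t` is a polynomial with value `v` at `t = -1`. -/
def HasVal (r : RatFunc K) (v : K) : Prop :=
  ∃ p : Polynomial K, algebraMap _ _ p = r ∧ p.eval (-1) = v

theorem HasVal.add {r s : RatFunc K} {v w : K} (hr : HasVal r v) (hs : HasVal s w) :
    HasVal (r + s) (v + w) := by
  obtain ⟨p, rfl, rfl⟩ := hr
  obtain ⟨q, rfl, rfl⟩ := hs
  exact ⟨p + q, map_add _ _ _, Polynomial.eval_add⟩

theorem HasVal.mul {r s : RatFunc K} {v w : K} (hr : HasVal r v) (hs : HasVal s w) :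
    HasVal (r * s) (v * w) := by
  obtain ⟨p, rfl, rfl⟩ := hr
  obtain ⟨q, rfl, rfl⟩ := hs
  exact ⟨p * q, map_mul _ _ _, Polynomial.eval_mul⟩

theorem hasVal_C (c : K) : HasVal (RatFunc.C c) c :=
  ⟨Polynomial.C c, RatFunc.algebraMap_C c, Polynomial.eval_C⟩

theorem hasVal_one : HasVal (1 : RatFunc K) 1 := ⟨1, map_one _, Polynomial.eval_one⟩

theorem HasVal.sum {ι : Type*} (s : Finset ι) {r : ι → RatFunc K} {v : ι → K}
    (h : ∀ i ∈ s, HasVal (r i) (v i)) : HasVal (∑ i ∈ s, r i) (∑ i ∈ s, v i) := by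
  classical
  induction s using Finset.induction_on with
  | empty => exact ⟨0, by simp, by simp⟩
  | insert i s hi ih =>
    rw [sum_insert hi, sum_insert hi]
    exact (h i (mem_insert_self _ _)).add (ih fun j hj => h j (mem_insert_of_mem hj))

theorem HasVal.prod {ι : Type*} (s : Finset ι) {r : ι → RatFunc K} {v : ι → K}
    (h : ∀ i ∈ s, HasVal (r i) (v i)) : HasVal (∏ i ∈ s, r i) (∏ i ∈ s, v i) := by
  classical
  induction s using Finset.induction_on with
  | empty => exact hasVal_one
  | insert i s hi ih =>
    rw [prod_insert hi, prod_insert hi]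
    exact (h i (mem_insert_self _ _)).mul (ih fun j hj => h j (mem_insert_of_mem hj))

theorem HasVal.denom_eval_ne_zero {r : RatFunc K} {v : K} (h : HasVal r v) :
    r.denom.eval (-1) ≠ 0 := by
  obtain ⟨p, rfl, -⟩ := h
  simp

theorem HasVal.eval_eq {r : RatFunc K} {v : K} (h : HasVal r v) :
    r.eval (RingHom.id _) (-1) = v := by
  obtain ⟨p, rfl, rfl⟩ := h
  rw [RatFunc.eval_algebraMap]
  simp [Polynomial.eval₂_id]

/-- The denominator is free of t, so the quotient is a polynomial in t. For `w = 1` both quotients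
are 0 by the convention on division by zero. -/
theorem hasVal_linear (u w : K) :
    HasVal ((1 - RatFunc.X * RatFunc.C u) / (1 - RatFunc.C w)) ((1 - (-1) * u) / (1 - w)) := by
  have h : (1 - RatFunc.X * RatFunc.C u) / (1 - RatFunc.C w) =
      (1 - RatFunc.X * RatFunc.C u) * RatFunc.C (1 - w)⁻¹ := by
    rw [map_inv₀, map_sub, map_one, div_eq_mul_inv]
  rw [h, div_eq_mul_inv]
  refine HasVal.mul ⟨1 - Polynomial.X * Polynomial.C u, ?_, by simp⟩ (hasVal_C _)
  rw [map_sub, map_mul, map_one, RatFunc.algebraMap_X, RatFunc.algebraMap_C]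

theorem hasVal_headFactor {n : ℕ} (r : ℕ) (a : ℕ → K) (y : K) (u : Fin n → K) :
    HasVal (headFactor r (fun i => RatFunc.C (a i)) RatFunc.X (RatFunc.C y)
      fun j => RatFunc.C (u j)) (headFactor r a (-1) y u) := by
  have hlin : ∀ v : K, HasVal ((1 - RatFunc.X * (RatFunc.C y)⁻¹ * RatFunc.C v) /
      (1 - (RatFunc.C y)⁻¹ * RatFunc.C v)) ((1 - (-1) * y⁻¹ * v) / (1 - y⁻¹ * v)) := by
    intro v
    have := hasVal_linear (y⁻¹ * v) (y⁻¹ * v)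
    rwa [map_mul, map_inv₀, ← mul_assoc, ← mul_assoc] at this
  refine HasVal.mul (HasVal.mul ?_ ?_) (HasVal.prod _ fun j _ => (hlin _).mul ?_)
  · refine HasVal.prod _ fun i _ => ?_
    rw [← map_add]
    exact hasVal_C _
  · have := hasVal_linear (y⁻¹ ^ 2) (y⁻¹ ^ 2)
    rwa [map_pow, map_inv₀] at this
  · have := hlin (u j)⁻¹
    rwa [map_inv₀] at this

theorem Generic.ratFunc {ι : Type*} {x : ι → K} (h : Generic x) :
    Generic fun i => (RatFunc.C (x i) : RatFunc K) := by
  have hinj : Function.Injective (RatFunc.C : K →+* RatFunc K) := RatFunc.C_injective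
  refine ⟨fun i => ?_, fun i => ?_, fun i j hij => ?_, fun i j hij => ?_⟩
  · exact (map_ne_zero_iff _ hinj).2 (h.ne_zero i)
  · rw [← map_pow, ← map_one RatFunc.C]
    exact hinj.ne (h.sq_ne_one i)
  · exact hinj.ne (h.ne i j hij)
  · rw [← map_mul, ← map_one RatFunc.C]
    exact hinj.ne (h.mul_ne_one i j hij)

theorem coef_map {ι κ : Type*} [DecidableEq ι] [DecidableEq κ] (z : ι → K) (e : κ ↪ ι) (A : Finset κ) {l : ℕ} (s : Fin l → κ) :
    coef z (A.map e) (fun i => e (s i)) = coef (fun k => z (e k)) A s := by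
  have h1 : (Function.Injective (fun i => e (s i)) ∧ ∀ i, e (s i) ∈ A.map e) ↔
      (Function.Injective s ∧ ∀ i, s i ∈ A) := by
    simp only [mem_map' e]
    exact and_congr_left fun _ => e.injective.of_comp_iff s
  have h2 : A.map e \ univ.image (fun i => e (s i)) = (A \ univ.image s).map e := by
    ext m
    simp only [mem_sdiff, mem_map, mem_image, mem_univ, true_and, not_exists]
    constructor
    · rintro ⟨⟨k, hk, rfl⟩, h⟩
      exact ⟨k, ⟨hk, fun i hi => h i (by rw [hi])⟩, rfl⟩
    · rintro ⟨k, ⟨hk, h⟩, rfl⟩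
      exact ⟨⟨k, hk, rfl⟩, fun i hi => h i (e.injective hi)⟩
  unfold coef
  by_cases h : Function.Injective s ∧ ∀ i, s i ∈ A
  · rw [if_pos h, if_pos (h1.2 h), h2]
    simp only [prod_map]
    rfl
  · rw [if_neg h, if_neg fun h' => h (h1.1 h')]

section Recursion

variable {ι κ : Type*} [DecidableEq ι] [Fintype ι] [DecidableEq κ] [Fintype κ]

theorem altSum_map (z : ι → K) (f : ι → ℕ → K) (e : κ ↪ ι) (A : Finset κ) {l : ℕ}
    (mu : Fin l → ℕ) :
    altSum z f (A.map e) mu = altSum (fun k => z (e k)) (fun k => f (e k)) A mu := by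
  symm
  refine sum_of_injOn (fun s i => e (s i)) (fun s _ s' _ h => ?_) (fun _ _ => mem_univ _)
    (fun s _ hs => ?_) fun s _ => by rw [coef_map]
  · funext i
    exact e.injective (congrFun h i)
  · refine mul_eq_zero_of_left (if_neg fun h => hs ?_) _
    have := h.2
    simp only [mem_map] at this
    choose s' hs' hs'' using this
    exact ⟨s', mem_univ _, funext hs''⟩

theorem altSum_cons (z : ι → K) (f : ι → ℕ → K) (A : Finset ι) {l : ℕ}
    (mu : Fin (l + 1) → ℕ) :
    altSum z f A mu = ∑ k ∈ A, f k (mu 0) * (∏ m ∈ A.erase k, theta z k m) *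
      altSum z f (A.erase k) fun i => mu i.succ := by
  rw [altSum, ← (Fin.consEquiv fun _ => ι).sum_comp, Fintype.sum_prod_type,
    ← sum_subset (subset_univ A)]
  · refine sum_congr rfl fun k hk => ?_
    rw [altSum, mul_sum]
    refine sum_congr rfl fun s _ => ?_
    change coef z A (Fin.cons k s : Fin (l + 1) → ι) *
      ∏ i, f ((Fin.cons k s : Fin (l + 1) → ι) i) (mu i) = _
    rw [coef_cons _ _ _ _ hk, Fin.prod_univ_succ]
    simp only [Fin.cons_zero, Fin.cons_succ]
    ring
  · intro k _ hk
    refine sum_eq_zero fun s _ => mul_eq_zero_of_left (if_neg fun h => hk ?_) _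
    exact h.2 0

end Recursion

/-- At t = -1 the pair factors are `theta` in the z_i for either sign and come out of the sum; the
two signs of (x² + 1)/(x² - 1) assemble `oneRow`. -/
theorem sum_headFactor {n : ℕ} (r : ℕ) (a : ℕ → K) (x : Fin (n + 1) → K) (hx : Generic x)
    (i : Fin (n + 1)) :
    2 * ∑ ε : ℤˣ, headFactor r a (-1) (x i ^ ((ε : ℤˣ) : ℤ)) (fun j => x (i.succAbove j)) =
      oneRow a (x i) r * ∏ m ∈ univ.erase i, theta (fun i => x i + (x i)⁻¹) i m := by
  have hi := hx.ne_zero i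
  have hprod : ∏ m ∈ univ.erase i, theta (fun i => x i + (x i)⁻¹) i m =
      ∏ j, theta (fun i => x i + (x i)⁻¹) i (i.succAbove j) := by
    have : univ.erase i = univ.map i.succAboveEmb := by
      ext j
      refine Fin.succAboveCases i ?_ (fun j => ?_) j <;> simp [Fin.succAbove_ne]
    rw [this, prod_map]
    rfl
  have hfac : ∀ (ε : ℤˣ) (j : Fin n),
      (1 - -1 * (x i ^ ((ε : ℤˣ) : ℤ))⁻¹ * x (i.succAbove j)) /
        (1 - (x i ^ ((ε : ℤˣ) : ℤ))⁻¹ * x (i.succAbove j)) *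
      ((1 - -1 * (x i ^ ((ε : ℤˣ) : ℤ))⁻¹ * (x (i.succAbove j))⁻¹) /
        (1 - (x i ^ ((ε : ℤˣ) : ℤ))⁻¹ * (x (i.succAbove j))⁻¹)) =
      theta (fun i => x i + (x i)⁻¹) i (i.succAbove j) := by
    intro ε j
    have hij := (Fin.succAbove_ne i j).symm
    have hj := hx.ne_zero (i.succAbove j)
    have h1 := sub_ne_zero.2 (hx.ne i _ hij)
    have h2 := sub_ne_zero.2 (hx.mul_ne_one i _ hij)
    have h3 : (x i + (x i)⁻¹) - (x (i.succAbove j) + (x (i.succAbove j))⁻¹) ≠ 0 :=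
      sub_ne_zero.2 (hx.injective.ne hij)
    rw [div_mul_div_comm, theta]
    generalize x (i.succAbove j) = u at *
    generalize x i = y at *
    have h4 : (1 - y⁻¹ * u) * (1 - y⁻¹ * u⁻¹) = y⁻¹ * ((y + y⁻¹) - (u + u⁻¹)) := by
      field_simp
      ring
    have h5 : (1 - y * u) * (1 - y * u⁻¹) = y * ((y + y⁻¹) - (u + u⁻¹)) := by
      field_simp
      ring
    rcases Int.units_eq_one_or ε with rfl | rfl
    · simp only [Units.val_one, zpow_one]
      rw [h4, div_eq_div_iff (mul_ne_zero (inv_ne_zero hi) h3) h3]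
      field_simp
      ring
    · simp only [Units.val_neg, Units.val_one, zpow_neg, zpow_one, inv_inv]
      rw [h5, div_eq_div_iff (mul_ne_zero hi h3) h3]
      field_simp
      ring
  simp only [headFactor, hfac]
  rw [← sum_mul, ← mul_assoc, hprod]
  congr 1
  rw [UnitsInt.univ, sum_pair (by decide)]
  simp only [Units.val_neg, Units.val_one, zpow_neg, zpow_one, inv_inv, oneRow]
  have h2 := sub_ne_zero.2 (hx.sq_ne_one i)
  generalize x i = y at *
  have e1 : (1 - -1 * y⁻¹ ^ 2) / (1 - y⁻¹ ^ 2) = (y ^ 2 + 1) / (y ^ 2 - 1) := by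
    rw [← mul_div_mul_left _ (1 - y⁻¹ ^ 2) (pow_ne_zero 2 hi)]
    congr 1 <;> field_simp
    ring
  have e2 : (1 - -1 * y ^ 2) / (1 - y ^ 2) = -((y ^ 2 + 1) / (y ^ 2 - 1)) := by
    rw [← div_neg, neg_sub]
    congr 1
    ring
  rw [e1, e2]
  ring

theorem poincare_X_ne_zero (m : ℕ) : poincare m (RatFunc.X : RatFunc K) ≠ 0 := by
  have h : ∀ i : ℕ, 0 < i → (1 - RatFunc.X ^ i : RatFunc K) ≠ 0 := by
    intro i hi h0
    have h1 : algebraMap (Polynomial K) (RatFunc K) (1 - Polynomial.X ^ i) = 0 := by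
      rw [map_sub, map_pow, map_one, RatFunc.algebraMap_X, h0]
    have h2 := (map_eq_zero_iff _ (RatFunc.algebraMap_injective K)).1 h1
    have h3 := congrArg (Polynomial.eval 0) h2
    simp [hi.ne'] at h3
  refine prod_ne_zero_iff.2 fun i hi => div_ne_zero (h _ ?_) ?_
  · have := (mem_Icc.1 hi).1
    omega
  · simpa using h 1 one_pos

/-- Peeling a variable lowers `l` and `n` together, so the Poincaré factor of rank n - l is the same
in every summand and comes out, leaving a polynomial in t. Its value obeys the recursion
`altSum_cons`. -/
theorem hlSum_eq_poincare_mul (a : ℕ → K) {l n : ℕ} (hln : l ≤ n) (lam : Fin n → ℕ)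
    (mu : Fin l → ℕ) (h1 : ∀ i, lam (Fin.castLE hln i) = mu i)
    (h2 : ∀ i : Fin n, l ≤ i → lam i = 0) (x : Fin n → K) (hx : Generic x) :
    ∃ r v, HasVal r v ∧
      hlSum lam (fun i => RatFunc.C (a i)) RatFunc.X (fun i => RatFunc.C (x i)) =
        poincare (n - l) RatFunc.X * r ∧
      2 ^ l * v = altSum (fun i => x i + (x i)⁻¹) (fun i => oneRow a (x i)) univ mu := by
  induction l generalizing n with
  | zero =>
    obtain rfl : lam = fun _ => 0 := funext fun i => h2 i (Nat.zero_le _)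
    refine ⟨1, 1, hasVal_one, ?_, ?_⟩
    · rw [mul_one]
      refine hlSum_zero _ _ ?_ _ hx.ratFunc
      -- At t = 1 the polynomial `poincare 1 t` would be 0/0 = 0, so its nonvanishing shows that X ≠
      -- 1.
      have := poincare_X_ne_zero (K := K) 1
      intro h
      rw [h] at this
      simp [poincare] at this
    · rw [altSum_empty]
      norm_num
  | succ l ih =>
    obtain ⟨m, rfl⟩ : ∃ m, n = m + 1 := ⟨n - 1, by omega⟩
    have hlm : l ≤ m := by omega
    choose r v hr hsum hv using fun i : Fin (m + 1) => ih hlm (fun j => lam j.succ)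
      (fun j => mu j.succ) (fun j => h1 j.succ)
      (fun j hj => h2 j.succ (by rw [Fin.val_succ]; omega))
      (fun j => x (i.succAbove j)) (hx.comp Fin.succAbove_right_injective)
    refine ⟨∑ i, ∑ ε : ℤˣ, headFactor (lam 0) (fun i => RatFunc.C (a i)) RatFunc.X
      (RatFunc.C (x i ^ ((ε : ℤˣ) : ℤ))) (fun j => RatFunc.C (x (i.succAbove j))) * r i,
      ∑ i, ∑ ε : ℤˣ, headFactor (lam 0) a (-1) (x i ^ ((ε : ℤˣ) : ℤ))
        (fun j => x (i.succAbove j)) * v i, ?_, ?_, ?_⟩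
    · exact HasVal.sum _ fun i _ => HasVal.sum _ fun ε _ => (hasVal_headFactor _ _ _ _).mul (hr i)
    · rw [hlSum_succ, mul_sum]
      refine sum_congr rfl fun i _ => ?_
      rw [mul_sum]
      refine sum_congr rfl fun ε _ => ?_
      rw [hsum i, Nat.succ_sub_succ, map_zpow₀]
      ring
    · rw [altSum_cons, mul_sum]
      refine sum_congr rfl fun i _ => ?_
      have he : univ.erase i = univ.map i.succAboveEmb := by
        ext j
        refine Fin.succAboveCases i ?_ (fun j => ?_) j <;> simp [Fin.succAbove_ne]
      have h0 : lam 0 = mu 0 := h1 0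
      have e1 : altSum (fun i => x i + (x i)⁻¹) (fun i => oneRow a (x i)) (univ.erase i)
          (fun j : Fin l => mu j.succ) = 2 ^ l * v i := by
        rw [he, altSum_map, hv i]
        rfl
      rw [e1, ← sum_headFactor _ a x hx i, ← sum_mul, h0, pow_succ]
      ring

end Specialization

/-! ### Genericity of the variables, the normalizing factor, and tableaux as fillings -/

section RationalFunctions

theorem generic_xVar {F : Type*} [Field F] [CharZero F] (n : ℕ) :
    Generic (xVar (n := n) F) := by
  have hinj := IsFractionRing.injective (MvPolynomial (Fin n) F) (RatField n F)
  have key : ∀ (p q : MvPolynomial (Fin n) F) (y : Fin n → F),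
      MvPolynomial.eval y p ≠ MvPolynomial.eval y q →
      algebraMap _ (RatField n F) p ≠ algebraMap _ (RatField n F) q :=
    fun p q y h h' => h (by rw [hinj h'])
  refine ⟨fun i => ?_, fun i => ?_, fun i j hij => ?_, fun i j hij => ?_⟩
  · have := key (MvPolynomial.X i) 0 (fun _ => 1) (by simp)
    rwa [map_zero] at this
  · have := key (MvPolynomial.X i ^ 2) 1 (fun _ => 0) (by simp)
    rwa [map_one, map_pow] at this
  · exact key (MvPolynomial.X i) (MvPolynomial.X j) (Pi.single i 1) (by simp [hij.symm])
  · have := key (MvPolynomial.X i * MvPolynomial.X j) 1 (fun _ => 0) (by simp)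
    rwa [map_one, map_mul] at this

instance {F : Type*} [Field F] [CharZero F] (n : ℕ) : CharZero (RatField n F) := by
  have : CharZero (MvPolynomial (Fin n) F) :=
    charZero_of_injective_algebraMap (MvPolynomial.C_injective (Fin n) F)
  exact charZero_of_injective_algebraMap
    (IsFractionRing.injective (MvPolynomial (Fin n) F) (RatField n F))

theorem lt_length_iff {n : ℕ} {lam : Fin n → ℕ} (hlam : Antitone lam) (i : Fin n) :
    (i : ℕ) < length lam ↔ lam i ≠ 0 := by
  constructor
  · intro h h0
    have hsub : ({j | lam j ≠ 0} : Finset (Fin n)) ⊆ ({j | (j : ℕ) < i} : Finset (Fin n)) := by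
      intro j hj
      simp only [mem_filter, mem_univ, true_and] at hj ⊢
      by_contra hc
      have := hlam (Fin.le_def.2 (not_lt.1 hc))
      omega
    have := card_le_card hsub
    rw [Fin.card_filter_val_lt] at this
    rw [length] at h
    omega
  · intro h
    have hsub : ({j | (j : ℕ) < i + 1} : Finset (Fin n)) ⊆ ({j | lam j ≠ 0} : Finset (Fin n)) := by
      intro j hj
      simp only [mem_filter, mem_univ, true_and] at hj ⊢
      have := hlam (Fin.le_def.2 (Nat.lt_succ_iff.1 hj))
      omega
    have := card_le_card hsub
    rw [Fin.card_filter_val_lt] at this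
    have := i.2
    rw [length]
    omega

theorem length_le {n : ℕ} (lam : Fin n → ℕ) : length lam ≤ n :=
  (card_le_univ _).trans_eq (Fintype.card_fin n)

theorem mult_zero {n : ℕ} (lam : Fin n → ℕ) : mult lam 0 = n - length lam := by
  have h := card_filter_add_card_filter_not (s := (univ : Finset (Fin n))) (fun i => lam i = 0)
  rw [card_univ, Fintype.card_fin] at h
  rw [mult, length]
  simp only [ne_eq]
  omega

/-- Each positive part has multiplicity one and contributes (1 - t)/(1 - t) = 1. -/
theorem vFactor_X {K : Type*} [Field K] {n : ℕ} (lam : Fin n → ℕ) (hlam : IsStrictPartition lam) :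
    vFactor lam (RatFunc.X : RatFunc K) = poincare (n - length lam) RatFunc.X := by
  rw [vFactor, mult_zero]
  refine mul_eq_left₀ (poincare_X_ne_zero _) |>.2 (prod_eq_one ?_)
  · intro k hk
    obtain ⟨hk0, hk⟩ := mem_erase.1 hk
    obtain ⟨i, -, hi⟩ := mem_image.1 hk
    have h1 : mult lam k = 1 := by
      rw [mult, card_eq_one]
      refine ⟨i, ?_⟩
      ext j
      simp only [mem_filter, mem_univ, true_and, mem_singleton]
      refine ⟨fun hj => ?_, fun h => h ▸ hi⟩
      by_contra hne
      rcases lt_or_gt_of_ne hne with h | h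
      · have := hlam.2 j i h (by omega)
        omega
      · have := hlam.2 i j h (by omega)
        omega
    have h2 := poincare_X_ne_zero (K := K) 1
    rw [h1, Icc_self, prod_singleton, pow_one, div_self]
    intro h0
    simp [poincare, h0] at h2

theorem sum_tableaux {F : Type*} [Field F] {n : ℕ} (a : ℕ → F) (lam : Fin n → ℕ) :
    ∑ T ∈ tableaux lam, tableauWeight a T =
      fillingSum (fun i => algebraMap F (RatField n F) (a i)) (xVar F) lam
        (fun _ _ t => t.rank < 4 * n) := by
  refine sum_congr ?_ fun _ _ => rfl
  ext T
  rw [mem_fillings, show T ∈ tableaux lam ↔ IsTableau T by simp [tableaux]]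
  constructor
  · exact fun h => ⟨⟨h.1, h.2, h.3, h.4, h.5⟩, fun c => (Letter.index_lt_iff _ _).1 (T c).index.2⟩
  · exact fun h => ⟨h.1.1, h.1.2, h.1.3, h.1.4, h.1.5⟩

end RationalFunctions

end SymplecticQ

end

/-- The specialization at `t = -1` defining `facQ` is legitimate (the factorial Hall–Littlewood
function has no pole there), and `facQ` is the generating function of symplectic primed shifted
tableaux. -/
theorem mainTheorem2 {F : Type*} [Field F] [CharZero F] (n : ℕ) (a : ℕ → F) (ha : a 0 = 0)
    (lam : Fin n → ℕ) (hlam : SymplecticQ.IsStrictPartition lam) :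
    (SymplecticQ.facHL lam a).denom.eval (-1) ≠ 0 ∧
      SymplecticQ.facQ lam a =
        ∑ T ∈ SymplecticQ.tableaux lam, SymplecticQ.tableauWeight a T := by
  open SymplecticQ in
  have hl := length_le lam
  have hx := generic_xVar (F := F) n
  have hzero : ∀ i : Fin n, length lam ≤ i → lam i = 0 := fun i hi => by
    by_contra h
    exact absurd ((lt_length_iff hlam.1 i).2 h) hi.not_gt
  have hpos : ∀ i : Fin (length lam), 0 < lam (Fin.castLE hl i) := fun i =>
    Nat.pos_of_ne_zero ((lt_length_iff hlam.1 _).1 i.2)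
  obtain ⟨r, v, hr, hsum, hv⟩ := hlSum_eq_poincare_mul
    (fun i => algebraMap F (RatField n F) (a i)) hl lam (fun i => lam (Fin.castLE hl i))
    (fun _ => rfl) hzero (xVar F) hx
  -- The normalizing factor is cancelled while t is still an indeterminate.
  have hHL : facHL lam a = r := by
    change 1 / vFactor lam RatFunc.X * hlSum lam _ _ _ = r
    rw [vFactor_X lam hlam, hsum, one_div, inv_mul_cancel_left₀ (poincare_X_ne_zero _)]
  rw [facQ, facP, hHL]
  refine ⟨hr.denom_eval_ne_zero, ?_⟩
  have hanti : StrictAnti fun i => lam (Fin.castLE hl i) := fun i j hij =>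
    hlam.2 _ _ hij (hpos i).ne'
  rw [hr.eval_eq, hv, sum_tableaux, fillingSum_of_zero_rows _ _ hl (fun _ => rfl) hzero,
    fillingSum_eq_altSum _ (by rw [ha, map_zero]) _ hx n le_rfl _ hanti hpos]
  congr 1
  ext i
  simp
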